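/- Let $n\ge 0$, and let $\alpha=(a_1,\dots,a_k)$ be a composition of $n$. Work in the ring of formal power series in variables $x_1,x_2,\dots$ over a commutative ring (e.g. $\mathbb Z$ or $\mathbb Q$). **Order and bases.** For compositions of $n$, write $\beta\le\gamma$ if $\gamma$ is obtained from $\beta$ by summing adjacent parts. Let $M_\beta=\sum_{i_1<\cdots<i_l}x_{i_1}^{b_1}\cdots x_{i_l}^{b_l}$ for $\beta=(b_1,\dots,b_l)$, and $F_\beta=\sum_{\gamma\le\beta}M_\gamma$. **The functions $P_\alpha$.** A filling of $\alpha$ is a $k\times k$ array whose row $i$ has the single entry $a_i$, in some column. It is *strict diagonal* if $a_1$ is in the first column and, for $i\ge 2$, $a_i$ is in the column directly to the right of that of $a_{i-1}$ or, only if $a_{i-1}\ge a_i$, in the same column as $a_{i-1}$. Let $\mathcal{DD}(\alpha)$ be the set of all distinct fillings obtained from strict diagonal fillings of $\alpha$ by permuting rows that contain equal parts. For a filling $\mathsf F$ let $\mathsf{col}(\mathsf F)$ be the composition of its nonzero column sums, from left to right. Put $P_\alpha=\sum_{\mathsf F\in\mathcal{DD}(\alpha)}M_{\mathsf{col}(\mathsf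 F)}$. **The compositions $C(\alpha)$, $T(\alpha)$.** Cut $\alpha$ between $a_i$ and $a_{i+1}$ whenever $a_i<a_{i+1}$; $C(\alpha)$ is the sequence of the sums of the resulting weakly decreasing runs. Cut $\alpha$ between $a_i$ and $a_{i+1}$ whenever $a_i\le a_{i+1}$ into strictly decreasing runs $\gamma_1|\cdots|\gamma_m$; then $T(\alpha)=\gamma_1'|\cdots|\gamma_m'$ (concatenation), where $\gamma'$ is the ribbon transpose, i.e. the sequence of column lengths, from left to right, of the ribbon $R(\gamma)$. Here $R(\gamma)$ is the ribbon with row lengths $\gamma$ from top to bottom, in which each row starts directly below the last box of the row above. **Descent Ribbons algorithm.** Let $\beta=(b_1,\dots,b_l)$ be a composition of $n$. Boxes of ribbons are ordered from the top left end to the bottom right end. Start with $\mathsf{ht}=0$, $R=R(\beta)$ and $(R_1,\dots,R_n)=(\emptyset,\dots,\emptyset)$. For $i=1,\dots,k$: 1. Add one box to $R_{a_i}$ at its bottom right end: southeast of its last box if $i=1$ or $a_{i-1}\ne a_i$; directly south of its last box if $i>1$, $a_{i-1}=a_i$ and $R$ is (up to translation) $R(b_j,\dots,b_l)$ for some $j$;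 directly east of its last box if $i>1$, $a_{i-1}=a_i$ and there is no such $j$. (The first box of an empty ribbon is placed anywhere.) 2. Add to $\mathsf{ht}$ the number of rows met by the first $a_i$ boxes of $R$, minus $1$. 3. Remove the first $a_i$ boxes from $R$. Let $\mathsf{ht}(\beta,\alpha)$ and $D(\beta,\alpha)=(R_1,\dots,R_n)$ be the final values. Let $\mathsf{SDR}(\beta,\alpha)$ be the set of fillings of $D(\beta,\alpha)$ in which each $R_j$ is filled with the numbers $1,\dots,|R_j|$, each used once, such that entries increase from left to right along each row and decrease from top to bottom along each column. **Theorem.** For every composition $\alpha$, $$P_\alpha=\sum_{T(\alpha)\le\beta\le C(\alpha)}(-1)^{\mathsf{ht}(\beta,\alpha)}\,|\mathsf{SDR}(\beta,\alpha)|\,F_\beta .$$ -/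

import Mathlib

namespace QSymPower

/-! ### Compositions: refinement, the coarsest and finest compositions `C` and `T` -/

/-- The refinement order `α ≤ β` on compositions of `n`: `β` is obtained from `α` by summing
adjacent parts. Equivalently, every partial sum of `β` is a partial sum of `α`. -/
def Refines {n : ℕ} (α β : Composition n) : Prop :=
  β.boundaries ⊆ α.boundaries

instance {n : ℕ} (α β : Composition n) : Decidable (Refines α β) :=
  inferInstanceAs (Decidable (β.boundaries ⊆ α.boundaries))

/-- The transpose of the ribbon whose rows, from top to bottom, have lengths `γ`: the list of the
lengths of its columns, from left to right. (The last box of a row lies directly above the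
first box of the next row, so a row `g` contributes `g - 1` columns with a single box, and its last
box lies on top of the first column of the remaining ribbon.) -/
def transpose : List ℕ → List ℕ
  | [] => []
  | g :: γ => List.replicate (g - 1) 1 ++
      match transpose γ with
      | [] => [1]
      | c :: cs => (c + 1) :: cs

theorem transpose_pos (γ : List ℕ) : ∀ i ∈ transpose γ, 0 < i := by
  induction γ with
  | nil => simp [transpose]
  | cons g γ ih =>
    intro i hi
    rw [transpose, List.mem_append] at hi
    rcases hi with hi | hi
    · rw [List.eq_of_mem_replicate hi]; exact Nat.one_pos
    · cases h : transpose γ with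
      | nil => simp [h] at hi; omega
      | cons c cs =>
        simp only [h, List.mem_cons] at hi ih
        rcases hi with rfl | hi
        · omega
        · exact ih i (Or.inr hi)

theorem transpose_sum (γ : List ℕ) (hγ : ∀ i ∈ γ, 0 < i) : (transpose γ).sum = γ.sum := by
  induction γ with
  | nil => simp [transpose]
  | cons g γ ih =>
    have hg := hγ g (by simp)
    have ih' := ih fun i hi => hγ i (by simp [hi])
    rw [transpose]
    cases h : transpose γ with
    | nil => simp [h] at ih' ⊢; omega
    | cons c cs => simp [h] at ih' ⊢; omega

theorem pos_of_mem_splitBy {r : ℕ → ℕ → Bool} {n : ℕ} (α : Composition n) {γ : List ℕ}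
    (hγ : γ ∈ α.blocks.splitBy r) : ∀ i ∈ γ, 0 < i := by
  intro i hi
  apply α.blocks_pos
  rw [← List.flatten_splitBy r α.blocks]
  exact List.mem_flatten.2 ⟨γ, hγ, hi⟩

/-- `C(α)`: cut `α` between `a_i` and `a_{i+1}` whenever `a_i < a_{i+1}`, and replace each of the
resulting weakly decreasing runs by its sum. -/
def compC {n : ℕ} (α : Composition n) : Composition n where
  blocks := (α.blocks.splitBy fun a b => decide (b ≤ a)).map List.sum
  blocks_pos := by
    intro i hi
    obtain ⟨γ, hγ, rfl⟩ := List.mem_map.1 hi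
    have hne : γ ≠ [] := List.ne_nil_of_mem_splitBy hγ
    exact List.sum_pos _ (pos_of_mem_splitBy α hγ) hne
  blocks_sum := by
    rw [← List.sum_flatten, List.flatten_splitBy, α.blocks_sum]

/-- `T(α)`: cut `α` between `a_i` and `a_{i+1}` whenever `a_i ≤ a_{i+1}`, replace each of the
resulting strictly decreasing runs by its ribbon transpose, and concatenate. -/
def compT {n : ℕ} (α : Composition n) : Composition n where
  blocks := ((α.blocks.splitBy fun a b => decide (b < a)).map transpose).flatten
  blocks_pos := by
    intro i hi
    obtain ⟨l, hl, hil⟩ := List.mem_flatten.1 hi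
    obtain ⟨γ, -, rfl⟩ := List.mem_map.1 hl
    exact transpose_pos γ i hil
  blocks_sum := by
    rw [List.sum_flatten, List.map_map]
    have h : (α.blocks.splitBy fun a b => decide (b < a)).map (List.sum ∘ transpose) =
        (α.blocks.splitBy fun a b => decide (b < a)).map List.sum :=
      List.map_congr_left fun γ hγ => transpose_sum γ (pos_of_mem_splitBy α hγ)
    rw [h, ← List.sum_flatten, List.flatten_splitBy, α.blocks_sum]

/-! ### Quasisymmetric functions, as power series in the variables `x_0, x_1, x_2, …` -/

open Classical in
/-- The monomial quasisymmetric function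
`M_α = ∑_{i_1 < ⋯ < i_k} x_{i_1}^{a_1} ⋯ x_{i_k}^{a_k}`, given by its coefficients. (As the parts
of `α` are positive, distinct index sequences give distinct monomials.) -/
noncomputable def monomialQ (R : Type*) [CommRing R] {n : ℕ} (α : Composition n) :
    MvPowerSeries ℕ R :=
  fun e => if ∃ i : Fin α.length → ℕ, StrictMono i ∧
      e = ∑ j, Finsupp.single (i j) (α.blocksFun j) then 1 else 0

/-- The fundamental quasisymmetric function `F_α = ∑_{β ≤ α} M_β`. -/
noncomputable def fundamentalQ (R : Type*) [CommRing R] {n : ℕ} (α : Composition n) :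
    MvPowerSeries ℕ R :=
  ∑ β : Composition n with Refines β α, monomialQ R β

/-! ### Fillings and the descending quasisymmetric power sums

A filling of `α = (a_1, …, a_k)` is a `k × k` array whose row `i` has the single entry `a_i`. It is
given by the function `c : Fin k → Fin k` that sends a row to the column of its entry. -/

/-- Strict diagonal fillings: `a_1` is in the first column, and `a_{i+1}` is either in the column
directly to the right of that of `a_i` or, only if `a_i ≥ a_{i+1}`, in the same column as `a_i`. -/
def IsStrictDiagonal {n : ℕ} (α : Composition n) (c : Fin α.length → Fin α.length) : Prop :=
  (∀ i : Fin α.length, (i : ℕ) = 0 → (c i : ℕ) = 0) ∧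
  ∀ i j : Fin α.length, (j : ℕ) = i + 1 →
    (c j : ℕ) = c i + 1 ∨ (α.blocksFun j ≤ α.blocksFun i ∧ c j = c i)

instance {n : ℕ} (α : Composition n) (c : Fin α.length → Fin α.length) :
    Decidable (IsStrictDiagonal α c) := by
  unfold IsStrictDiagonal; infer_instance

/-- The set `DD(α)` of diagonal descending fillings: the fillings obtained from the strict diagonal
ones by permuting rows that contain equal parts. (Exchanging rows with equal parts in the same
column does not change the filling.) -/
def DD {n : ℕ} (α : Composition n) : Finset (Fin α.length → Fin α.length) :=
  {c | ∃ σ : Equiv.Perm (Fin α.length),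
    (∀ i, α.blocksFun (σ i) = α.blocksFun i) ∧ IsStrictDiagonal α (c ∘ σ)}

/-- The column sum of a filling: the composition formed by the nonzero column sums, from left to
right. -/
def colSum {n : ℕ} (α : Composition n) (c : Fin α.length → Fin α.length) : Composition n where
  blocks := (List.ofFn fun j => ∑ i with c i = j, α.blocksFun i).filter (fun s => decide (0 < s))
  blocks_pos := by
    intro i hi
    simpa using (List.mem_filter.1 hi).2
  blocks_sum := by
    have h : ∀ l : List ℕ, (l.filter (fun s => decide (0 < s))).sum = l.sum := by
      intro l
      induction l with
      | nil => rfl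
      | cons a l ih =>
        by_cases ha : 0 < a
        · simp [ha, ih]
        · obtain rfl : a = 0 := by omega
          simpa using ih
    rw [h, List.sum_ofFn, Finset.sum_fiberwise, α.sum_blocksFun]

/-- The descending quasisymmetric power sum `P_α = ∑_{F ∈ DD(α)} M_{col(F)}`. -/
noncomputable def powerQ (R : Type*) [CommRing R] {n : ℕ} (α : Composition n) :
    MvPowerSeries ℕ R :=
  ∑ c ∈ DD α, monomialQ R (colSum α c)

/-! ### Ribbons and the Descent Ribbons algorithm

A box is a pair (row, column); rows are numbered from top to bottom and columns from left to right.
A (possibly disconnected) ribbon is the list of its boxes, from the top left end to the bottom right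
end. -/

/-- The ribbon with row lengths `b_1, b_2, …` (from top to bottom) whose first box is `(r, c)`; each
row starts directly below the last box of the row above. -/
def ribbonAt : ℕ × ℕ → List ℕ → List (ℕ × ℕ)
  | _, [] => []
  | (r, c), b :: bs => (List.range b).map (fun t => (r, c + t)) ++ ribbonAt (r + 1, c + b - 1) bs

/-- The height of a ribbon: the number of rows that it meets. -/
def height (R : List (ℕ × ℕ)) : ℕ := (R.map Prod.fst).toFinset.card

/-- Extend a ribbon at its bottom right end by the box in relative position `d`. The first box of a
ribbon is placed at `(0, 0)`. -/
def extend (R : List (ℕ × ℕ)) (d : ℕ × ℕ) : List (ℕ × ℕ) :=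
  R ++ [match R.getLast? with
    | none => (0, 0)
    | some x => x + d]

/-- The variables of the algorithm: the height, the remaining part `R` of the ribbon of `β`, and the
tuple `(R_1, …, R_n)`, where `R_{k+1}` is stored at `k : Fin n`. -/
structure State (n : ℕ) where
  ht : ℕ
  R : List (ℕ × ℕ)
  D : Fin n → List (ℕ × ℕ)

/-- The direction in which a box is added when the current part of `α` is `a` and the previous one
is `prev` (`none` in the first step): southeast `(1, 1)` in the first step and when `a` differs from
the previous part; otherwise south `(1, 0)` if `R` is (up to translation) the ribbon of
`(b_j, …, b_l)` for some `j`, and east `(0, 1)` if not. -/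
def direction (β : List ℕ) (prev : Option ℕ) (a : ℕ) (R : List (ℕ × ℕ)) : ℕ × ℕ :=
  if prev ≠ some a then (1, 1)
  else if ∃ j < β.length, ribbonAt (R.headD (0, 0)) (β.drop j) = R then (1, 0)
  else (0, 1)

/-- One pass through the loop, for the part `a` of `α`. (The ribbon of the first `a` boxes of `R` has
height at least `1`, so the subtraction does not truncate.) -/
def step {n : ℕ} (β : List ℕ) (prev : Option ℕ) (a : ℕ) (s : State n) : State n where
  ht := s.ht + height (s.R.take a) - 1
  R := s.R.drop a
  D := fun k => if (k : ℕ) + 1 = a then extend (s.D k) (direction β prev a s.R) else s.D k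

/-- The loop over the parts of `α`. -/
def loop {n : ℕ} (β : List ℕ) : Option ℕ → List ℕ → State n → State n
  | _, [], s => s
  | prev, a :: as, s => loop β (some a) as (step β prev a s)

/-- The output of the Descent Ribbons algorithm. -/
def descentRibbons {n : ℕ} (β α : Composition n) : State n :=
  loop β.blocks none α.blocks ⟨0, ribbonAt (0, 0) β.blocks, fun _ => []⟩

/-- The height `ht(β, α)`. -/
def ht {n : ℕ} (β α : Composition n) : ℕ := (descentRibbons β α).ht

/-- The tuple of ribbons `D(β, α)`. -/
def D {n : ℕ} (β α : Composition n) : Fin n → List (ℕ × ℕ) := (descentRibbons β α).D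

/-- A standard filling of the ribbon `R` with `m` boxes, given as a permutation (the `i`-th box
contains `f i`, where the numbers `1, …, m` are represented by `0, …, m - 1`), is a standard descent
filling if the entries increase from left to right along each row and decrease from top to bottom
along each column. -/
def IsStandardDescent (R : List (ℕ × ℕ)) (f : Equiv.Perm (Fin R.length)) : Prop :=
  ∀ i j : Fin R.length,
    ((R.get i).1 = (R.get j).1 → (R.get i).2 < (R.get j).2 → f i < f j) ∧
    ((R.get i).2 = (R.get j).2 → (R.get i).1 < (R.get j).1 → f j < f i)

instance (R : List (ℕ × ℕ)) (f : Equiv.Perm (Fin R.length)) :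
    Decidable (IsStandardDescent R f) := by
  unfold IsStandardDescent; infer_instance

/-- `SDR(β, α)`: the fillings of the tuple `D(β, α)` such that each of its ribbons has a standard
descent filling. -/
def SDR {n : ℕ} (β α : Composition n) :
    Finset (∀ k : Fin n, Equiv.Perm (Fin (D β α k).length)) :=
  {f | ∀ k, IsStandardDescent (D β α k) (f k)}

end QSymPower

namespace QSymPower

/-! ### Splitting a list into runs -/

/-! Compositions of `n` are encoded by their sets of cuts in `Fin (n - 1)`. The theorem is then
proved by comparing the contributions of each `M_γ`. Write `A`, `B`, `G` for the cuts of `α`, `β`,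
`γ`.

Left side. At most one strict diagonal filling `d` has column sums `γ`; it exists iff `G ⊆ A` and
`G` contains every ascent of `α`. The fillings counted by `P_α` are the `d ∘ σ⁻¹`, with `σ` a
permutation of the rows preserving parts. Distinct fillings correspond to those `σ` that increase on
rows with equal part and equal column. Let `X σ` consist of the ascents of `α` and of the positions
between adjacent equal parts where `σ` descends. The number of fillings is the number of `σ` with `X
σ ⊆ G ⊆ A` (`card_filter_DD_colSum`).

Right side. The algorithm breaks the ribbon of `β` at the cuts of `α`, so `ht` is `|B \ A|`
(`ht_eq_card`). A box added after an equal part goes south exactly at a cut of `β`, so standard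
fillings correspond to the `σ` whose descents between adjacent equal parts are the cuts of `β` there
(`card_SDR`). Together with `T(α) ≤ β ≤ C(α)` this says `B ∩ A = X σ`.

Hence the coefficient on the right is the sum, over `σ` and over `B ⊆ G` with `B ∩ A = X σ`, of
`(-1)^|B \ A|`. For fixed `σ` with `X σ ⊆ G` the set `B \ A` runs through all subsets of `G \ A`, so
everything cancels unless `G ⊆ A` (`sum_neg_one_pow_card_sdiff`). The same count of `σ` remains. -/

theorem splitBy_loop_acc {α : Type*} (r : α → α → Bool) (l : List α) (a : α) (g : List α)
    (gs : List (List α)) :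
    List.splitBy.loop r l a g gs = gs.reverse ++ List.splitBy.loop r l a g [] := by
  induction l generalizing a g gs with
  | nil => simp [List.splitBy.loop]
  | cons b l ih =>
    simp only [List.splitBy.loop]
    split
    · exact ih _ _ _
    · rw [ih, ih _ _ [_]]; simp

/-- The accumulator `g` holds the current run in reverse, so an element appended to `g` becomes the
head of the first finished run. -/
theorem splitBy_loop_append_singleton {α : Type*} (r : α → α → Bool) (l : List α) (a b : α)
    (g : List α) :
    ∃ m L, List.splitBy.loop r l b g [] = m :: L ∧
      List.splitBy.loop r l b (g ++ [a]) [] = (a :: m) :: L := by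
  induction l generalizing b g with
  | nil => exact ⟨_, _, rfl, by simp [List.splitBy.loop]⟩
  | cons c l ih =>
    simp only [List.splitBy.loop]
    split
    · simpa using ih c (b :: g)
    · rw [splitBy_loop_acc, splitBy_loop_acc (gs := [_])]
      exact ⟨(b :: g).reverse, _, by simp; rfl, by simp⟩

theorem splitBy_singleton {α : Type*} (r : α → α → Bool) (a : α) :
    [a].splitBy r = [[a]] := rfl

theorem splitBy_cons_cons_of_true {α : Type*} {r : α → α → Bool} {a b : α} (h : r a b = true)
    (l : List α) :
    ∃ m L, (b :: l).splitBy r = m :: L ∧ (a :: b :: l).splitBy r = (a :: m) :: L := by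
  simp only [List.splitBy, List.splitBy.loop, h]
  exact splitBy_loop_append_singleton r l a b []

theorem splitBy_cons_cons_of_false {α : Type*} {r : α → α → Bool} {a b : α} (h : r a b = false)
    (l : List α) :
    (a :: b :: l).splitBy r = [a] :: (b :: l).splitBy r := by
  simp only [List.splitBy, List.splitBy.loop, h]
  rw [splitBy_loop_acc]
  simp

/-! ### Partial sums -/

/-- The set of the partial sums of a list. -/
def partialSums (l : List ℕ) : Set ℕ := {q | ∃ m, (l.take m).sum = q}

theorem zero_mem_partialSums (l : List ℕ) : 0 ∈ partialSums l := ⟨0, by simp⟩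

theorem mem_partialSums_nil {q : ℕ} : q ∈ partialSums [] ↔ q = 0 := by
  simp [partialSums, eq_comm]

theorem mem_partialSums_cons {a q : ℕ} {l : List ℕ} :
    q ∈ partialSums (a :: l) ↔ q = 0 ∨ ∃ s ∈ partialSums l, q = a + s := by
  constructor
  · rintro ⟨m, rfl⟩
    cases m with
    | zero => simp
    | succ m => exact Or.inr ⟨_, ⟨m, rfl⟩, by simp⟩
  · rintro (rfl | ⟨s, ⟨m, rfl⟩, rfl⟩)
    · exact zero_mem_partialSums _
    · exact ⟨m + 1, by simp⟩

theorem mem_partialSums_replicate_append {q g : ℕ} {l : List ℕ} :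
    q ∈ partialSums (List.replicate g 1 ++ l) ↔ q < g ∨ ∃ s ∈ partialSums l, q = g + s := by
  induction g generalizing q with
  | zero => simp
  | succ g ih =>
    rw [List.replicate_succ, List.cons_append, mem_partialSums_cons]
    simp only [ih]
    constructor
    · rintro (rfl | ⟨s, hs | ⟨t, ht, rfl⟩, rfl⟩)
      · left; omega
      · left; omega
      · exact Or.inr ⟨t, ht, by omega⟩
    · rintro (h | ⟨s, hs, rfl⟩)
      · rcases q with _ | q
        · simp
        · exact Or.inr ⟨q, Or.inl (by omega), by omega⟩
      · exact Or.inr ⟨g + s, Or.inr ⟨s, hs, rfl⟩, by omega⟩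

/-! ### Partial sums of `C(α)` and `T(α)` -/

/-- `q` is the sum of a proper initial segment of `l` whose last entry is in relation `r` to the
entry that follows it. -/
def IsStepSum (r : ℕ → ℕ → Prop) (l : List ℕ) (q : ℕ) : Prop :=
  ∃ (i : ℕ) (h : i + 1 < l.length), r l[i] l[i + 1] ∧ q = (l.take (i + 1)).sum

theorem not_isStepSum_singleton {r : ℕ → ℕ → Prop} {a q : ℕ} : ¬ IsStepSum r [a] q := by
  rintro ⟨i, h, -⟩
  simp at h

theorem isStepSum_cons_cons {r : ℕ → ℕ → Prop} {a b q : ℕ} {l : List ℕ} :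
    IsStepSum r (a :: b :: l) q ↔ (r a b ∧ q = a) ∨ ∃ s, IsStepSum r (b :: l) s ∧ q = a + s := by
  constructor
  · rintro ⟨i, h, hr, rfl⟩
    cases i with
    | zero => left; simpa using hr
    | succ i => exact Or.inr ⟨_, ⟨i, by simpa using h, by simpa using hr, rfl⟩, by simp⟩
  · rintro (⟨hr, rfl⟩ | ⟨s, ⟨i, h, hr, rfl⟩, rfl⟩)
    · exact ⟨0, by simp, by simpa using hr, by simp⟩
    · exact ⟨i + 1, by simpa using h, by simpa using hr, by simp⟩

theorem IsStepSum.pos {r : ℕ → ℕ → Prop} {l : List ℕ} (hl : ∀ i ∈ l, 0 < i) {q : ℕ}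
    (h : IsStepSum r l q) : 0 < q := by
  obtain ⟨i, h, -, rfl⟩ := h
  cases l with
  | nil => simp at h
  | cons a l => have := hl a (by simp); simp; omega

/-- Induction on the list: if `b ≤ a`, the entry `a` is absorbed into the first block, so every
nonzero partial sum shifts by `a` and none is created at `a`; otherwise `a` is a block of its own.
-/
theorem mem_partialSums_compC_blocks {l : List ℕ} (hl : ∀ i ∈ l, 0 < i) {q : ℕ} :
    q ∈ partialSums ((l.splitBy fun a b => decide (b ≤ a)).map List.sum) ↔
      q = 0 ∨ q = l.sum ∨ IsStepSum (· < ·) l q := by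
  induction l generalizing q with
  | nil => simp [mem_partialSums_nil, IsStepSum]
  | cons a l ih =>
    cases l with
    | nil =>
      simp [splitBy_singleton, mem_partialSums_cons, mem_partialSums_nil, not_isStepSum_singleton]
    | cons b l =>
      have ha := hl a (by simp)
      have hl' : ∀ i ∈ b :: l, 0 < i := fun i hi => hl i (by simp [hi])
      have hb := hl' b (by simp)
      replace ih := @ih hl'
      by_cases hab : b ≤ a
      · obtain ⟨m, L, h1, h2⟩ := splitBy_cons_cons_of_true
          (r := fun a b => decide (b ≤ a)) (decide_eq_true hab) l
        have hm : 0 < m.sum := by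
          have hmem : m ∈ (b :: l).splitBy fun a b => decide (b ≤ a) := by simp [h1]
          refine List.sum_pos _ (fun i hi => hl' i ?_) (List.ne_nil_of_mem_splitBy hmem)
          rw [← List.flatten_splitBy (fun a b => decide (b ≤ a)) (b :: l)]
          exact List.mem_flatten.2 ⟨m, hmem, hi⟩
        rw [h2, isStepSum_cons_cons]
        rw [h1] at ih
        simp only [List.map_cons, mem_partialSums_cons, List.sum_cons] at ih ⊢
        constructor
        · rintro (rfl | ⟨s, hs, rfl⟩)
          · simp
          · rcases ih.1 (Or.inr ⟨s, hs, rfl⟩) with h | h | h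
            · omega
            · right; left; omega
            · exact Or.inr (Or.inr (Or.inr ⟨_, h, by omega⟩))
        · rintro (rfl | h | ⟨h, -⟩ | ⟨s, hs, rfl⟩)
          · simp
          · obtain h' | ⟨s, hs, h'⟩ := ih.2 (Or.inr (Or.inl rfl))
            · omega
            · exact Or.inr ⟨s, hs, by omega⟩
          · omega
          · have := hs.pos hl'
            obtain h' | ⟨t, ht, h'⟩ := ih.2 (Or.inr (Or.inr hs))
            · omega
            · exact Or.inr ⟨t, ht, by omega⟩
      · rw [splitBy_cons_cons_of_false (by simpa using hab), isStepSum_cons_cons, List.map_cons,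
          mem_partialSums_cons]
        simp only [ih, List.sum_cons, List.sum_nil]
        constructor
        · rintro (rfl | ⟨s, rfl | rfl | h, rfl⟩)
          · simp
          · right; right; left; omega
          · simp
          · exact Or.inr (Or.inr (Or.inr ⟨s, h, by omega⟩))
        · rintro (rfl | rfl | ⟨-, rfl⟩ | ⟨s, hs, rfl⟩)
          · simp
          · exact Or.inr ⟨_, Or.inr (Or.inl rfl), by omega⟩
          · exact Or.inr ⟨0, by simp, by omega⟩
          · exact Or.inr ⟨s, Or.inr (Or.inr hs), by omega⟩

/-- A new top row of length `g` adds the cuts `1, …, g - 1`. Its last box lies on top of the old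
first column, so there is no cut at `g`, whence `s ≠ 0`. The tail `l` stands for the transposes of
the later runs. -/
theorem mem_partialSums_transpose_cons_append {g q : ℕ} (hg : 0 < g) {γ l : List ℕ} (hγ : γ ≠ []) :
    q ∈ partialSums (transpose (g :: γ) ++ l) ↔
      q < g ∨ ∃ s ∈ partialSums (transpose γ ++ l), s ≠ 0 ∧ q = g + s := by
  have hpos := transpose_pos γ
  cases h : transpose γ with
  | nil =>
    cases γ with
    | nil => simp at hγ
    | cons a γ => rw [transpose] at h; revert h; split <;> simp
  | cons c cs =>
    have hc : 0 < c := hpos c (by simp [h])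
    simp only [transpose, h, List.append_assoc, mem_partialSums_replicate_append, List.cons_append,
      mem_partialSums_cons]
    constructor
    · rintro (h | ⟨s, rfl | ⟨s, hs, rfl⟩, rfl⟩)
      · left; omega
      · left; omega
      · exact Or.inr ⟨c + s, Or.inr ⟨s, hs, rfl⟩, by omega, by omega⟩
    · rintro (h | ⟨s, rfl | ⟨s, hs, rfl⟩, h0, rfl⟩)
      · rcases Nat.lt_or_ge q (g - 1) with h | h
        · exact Or.inl h
        · exact Or.inr ⟨0, Or.inl rfl, by omega⟩
      · omega
      · exact Or.inr ⟨_, Or.inr ⟨s, hs, rfl⟩, by omega⟩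

/-- Transposing a ribbon complements its set of interior cuts, and consecutive runs are always
separated. Only the cuts inside strictly decreasing runs, that is, the strict descents, are
therefore lost. -/
theorem mem_partialSums_compT_blocks {l : List ℕ} (hl : ∀ i ∈ l, 0 < i) {q : ℕ} :
    q ∈ partialSums ((l.splitBy fun a b => decide (b < a)).map transpose).flatten ↔
      q ≤ l.sum ∧ ¬ IsStepSum (· > ·) l q := by
  induction l generalizing q with
  | nil => simp [mem_partialSums_nil, IsStepSum]
  | cons a l ih =>
    have ha := hl a (by simp)
    cases l with
    | nil =>
      simp only [splitBy_singleton, List.map_cons, List.map_nil, transpose, List.flatten_cons,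
        List.flatten_nil, List.append_nil, mem_partialSums_replicate_append, mem_partialSums_cons,
        mem_partialSums_nil, not_isStepSum_singleton, List.sum_cons, List.sum_nil]
      simp
      omega
    | cons b l =>
      have hl' : ∀ i ∈ b :: l, 0 < i := fun i hi => hl i (by simp [hi])
      have hb := hl' b (by simp)
      replace ih := @ih hl'
      rw [isStepSum_cons_cons]
      by_cases hab : b < a
      · obtain ⟨m, L, h1, h2⟩ := splitBy_cons_cons_of_true
          (r := fun a b => decide (b < a)) (decide_eq_true hab) l
        have hm : m ≠ [] := List.ne_nil_of_mem_splitBy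
          (r := fun a b => decide (b < a)) (l := b :: l) (by simp [h1])
        rw [h1] at ih
        rw [h2, List.map_cons, List.flatten_cons, mem_partialSums_transpose_cons_append ha hm]
        rw [List.map_cons, List.flatten_cons] at ih
        simp only [ih, List.sum_cons]
        constructor
        · rintro (h | ⟨s, ⟨hs, hs'⟩, h0, rfl⟩)
          · refine ⟨by omega, ?_⟩
            rintro (⟨-, rfl⟩ | ⟨s, -, rfl⟩) <;> omega
          · refine ⟨by omega, ?_⟩
            rintro (⟨-, h⟩ | ⟨t, ht, h⟩)
            · omega
            · obtain rfl : s = t := by omega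
              exact hs' ht
        · rintro ⟨h1, h2⟩
          rcases Nat.lt_or_ge q a with h | h
          · exact Or.inl h
          · have h3 : q ≠ a := fun h3 => h2 (Or.inl ⟨hab, h3⟩)
            exact Or.inr ⟨q - a, ⟨by simp; omega, fun h4 => h2 (Or.inr ⟨_, h4, by omega⟩)⟩,
              by omega, by omega⟩
      · rw [splitBy_cons_cons_of_false (by simpa using hab), List.map_cons, List.flatten_cons]
        simp only [transpose, List.append_assoc, mem_partialSums_replicate_append, List.cons_append,
          List.nil_append, mem_partialSums_cons, ih, List.sum_cons]
        constructor
        · rintro (h | ⟨s, rfl | ⟨s, ⟨hs, hs'⟩, rfl⟩, rfl⟩)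
          · refine ⟨by omega, ?_⟩
            rintro (⟨-, rfl⟩ | ⟨s, -, rfl⟩) <;> omega
          · refine ⟨by omega, ?_⟩
            rintro (⟨-, h⟩ | ⟨t, ht, h⟩) <;> omega
          · refine ⟨by omega, ?_⟩
            rintro (⟨h, -⟩ | ⟨t, ht, h⟩)
            · omega
            · obtain rfl : s = t := by omega
              exact hs' ht
        · rintro ⟨h1, h2⟩
          rcases Nat.lt_or_ge q (a - 1) with h | h
          · exact Or.inl h
          · rcases Nat.lt_or_ge q a with h' | h'
            · exact Or.inr ⟨0, Or.inl rfl, by omega⟩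
            · exact Or.inr ⟨q - a + 1, Or.inr ⟨q - a,
                ⟨by omega, fun h4 => h2 (Or.inr ⟨_, h4, by omega⟩)⟩, by omega⟩, by omega⟩

/-! ### Compositions and sets of cuts -/

/-- The set of the positions `j + 1` at which a composition of `n` is cut. -/
def cuts {n : ℕ} : Composition n ≃ Finset (Fin (n - 1)) :=
  (compositionEquiv n).trans (compositionAsSetEquiv n)

theorem mem_boundaries_iff {n : ℕ} {γ : Composition n} {q : Fin (n + 1)} :
    q ∈ γ.boundaries ↔ (q : ℕ) ∈ partialSums γ.blocks := by
  simp only [Composition.boundaries, Finset.mem_map, Finset.mem_univ, true_and, partialSums,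
    Set.mem_ofPred_eq]
  constructor
  · rintro ⟨i, rfl⟩
    exact ⟨i, rfl⟩
  · rintro ⟨m, hm⟩
    rcases Nat.lt_or_ge m (γ.length + 1) with h | h
    · exact ⟨⟨m, h⟩, Fin.ext hm⟩
    · refine ⟨Fin.last _, Fin.ext ?_⟩
      rw [← hm]
      change γ.sizeUpTo γ.length = γ.sizeUpTo m
      rw [γ.sizeUpTo_length, γ.sizeUpTo_ofLength_le m (by omega)]

theorem mem_cuts {n : ℕ} {γ : Composition n} {j : Fin (n - 1)} :
    j ∈ cuts γ ↔ (j : ℕ) + 1 ∈ partialSums γ.blocks := by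
  have h : j ∈ cuts γ ↔ (⟨1 + (j : ℕ), by omega⟩ : Fin (n + 1)) ∈ γ.boundaries := by
    simp [cuts, compositionEquiv, compositionAsSetEquiv, Composition.toCompositionAsSet]
  rw [h, mem_boundaries_iff, add_comm (j : ℕ)]

theorem self_mem_partialSums {n : ℕ} (γ : Composition n) : n ∈ partialSums γ.blocks :=
  ⟨γ.length, γ.sizeUpTo_length⟩

theorem refines_iff {n : ℕ} {α β : Composition n} : Refines α β ↔ cuts β ⊆ cuts α := by
  constructor
  · intro h j hj
    rw [mem_cuts] at hj ⊢
    have := @h ⟨j + 1, by omega⟩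
    simp only [mem_boundaries_iff] at this
    exact this hj
  · intro h q hq
    rw [mem_boundaries_iff] at hq ⊢
    rcases Nat.eq_zero_or_pos (q : ℕ) with h0 | h0
    · rw [h0]; exact zero_mem_partialSums _
    · rcases Nat.lt_or_ge (q : ℕ) n with h1 | h1
      · have := @h ⟨q - 1, by omega⟩
        simp only [mem_cuts, Nat.sub_add_cancel h0] at this
        exact this hq
      · rw [show (q : ℕ) = n by omega]; exact self_mem_partialSums _

theorem mem_cuts_compC {n : ℕ} {α : Composition n} {j : Fin (n - 1)} :
    j ∈ cuts (compC α) ↔ IsStepSum (· < ·) α.blocks (j + 1) := by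
  rw [mem_cuts]
  simp only [compC]
  rw [mem_partialSums_compC_blocks (fun i hi => α.blocks_pos hi), α.blocks_sum]
  have : (j : ℕ) + 1 ≠ n := by omega
  simp [this]

theorem mem_cuts_compT {n : ℕ} {α : Composition n} {j : Fin (n - 1)} :
    j ∈ cuts (compT α) ↔ ¬ IsStepSum (· > ·) α.blocks (j + 1) := by
  rw [mem_cuts]
  simp only [compT]
  rw [mem_partialSums_compT_blocks (fun i hi => α.blocks_pos hi), α.blocks_sum]
  have : (j : ℕ) + 1 ≤ n := by omega
  simp [this]

/-! ### Permutations that are increasing on the fibres of a function -/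

/-- The permutation `τ⁻¹σ` preserves the fibres of `f` and is increasing on each of them, hence is
the identity. -/
theorem perm_eq_of_increasing_on_fibers {k : ℕ} {X : Type*} (f : Fin k → X)
    {σ τ : Equiv.Perm (Fin k)} (h : ∀ i, f (σ.symm i) = f (τ.symm i))
    (hσ : ∀ i j, i < j → f i = f j → σ i < σ j) (hτ : ∀ i j, i < j → f i = f j → τ i < τ j) :
    σ = τ := by
  have hf : ∀ i, f (τ.symm (σ i)) = f i := fun i => by rw [← h, Equiv.symm_apply_apply]
  have hmono : ∀ i j, i < j → f i = f j → τ.symm (σ i) < τ.symm (σ j) := by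
    intro i j hij hfij
    by_contra hlt
    rcases (not_lt.1 hlt).lt_or_eq with h1 | h1
    · have := hτ _ _ h1 (by rw [hf, hf, hfij])
      rw [Equiv.apply_symm_apply, Equiv.apply_symm_apply] at this
      exact lt_asymm this (hσ _ _ hij hfij)
    · exact hij.ne (by simpa using h1.symm)
  have key : ∀ i, τ.symm (σ i) = i := by
    intro i
    induction i using WellFoundedLT.induction with
    | ind i ih =>
      rcases lt_trichotomy (τ.symm (σ i)) i with h1 | h1 | h1
      · have := ih _ h1
        simp only [EmbeddingLike.apply_eq_iff_eq] at this
        exact absurd this h1.ne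
      · exact h1
      · obtain ⟨l, hl⟩ : ∃ l, τ.symm (σ l) = i := ⟨σ.symm (τ i), by simp⟩
        have hfl : f i = f l := by rw [← hf l, hl]
        rcases lt_trichotomy l i with h2 | h2 | h2
        · have := ih _ h2
          rw [hl] at this
          exact absurd this h2.ne'
        · rw [h2] at hl; exact hl
        · have := hmono _ _ h2 hfl
          rw [hl] at this
          exact absurd this (lt_asymm h1)
  ext i
  rw [← τ.apply_symm_apply (σ i), key]

/-- Each fibre of `f` is matched in increasing order with the equally large fibre of `f ∘ τ⁻¹`. With
the preceding uniqueness, every coset of the stabiliser of `f` has one sorted representative. -/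
theorem exists_perm_increasing_on_fibers {k : ℕ} {X : Type*} (f : Fin k → X)
    (τ : Equiv.Perm (Fin k)) :
    ∃ σ : Equiv.Perm (Fin k), (∀ i, f (σ.symm i) = f (τ.symm i)) ∧
      ∀ i j, i < j → f i = f j → σ i < σ j := by
  classical
  let g : Fin k → X := fun i => f (τ.symm i)
  have hcard : ∀ x, Fintype.card {i // g i = x} = Fintype.card {i // f i = x} := fun x =>
    Fintype.card_congr (τ.symm.subtypeEquiv fun i => Iff.rfl)
  let e : ∀ x, {i // f i = x} ≃o {i // g i = x} := fun x =>
    (Fintype.orderIsoFinOfCardEq {i // f i = x} rfl).symm.trans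
      (Fintype.orderIsoFinOfCardEq {i // g i = x} (hcard x))
  -- The value `x` is kept free so that two points of one fibre can be compared through the same `e
  -- x`.
  have hval : ∀ i x (h : f i = x),
      Equiv.ofFiberEquiv (fun x => (e x).toEquiv) i = (e x ⟨i, h⟩ : Fin k) := by
    rintro i _ rfl; rfl
  refine ⟨Equiv.ofFiberEquiv fun x => (e x).toEquiv, fun i => ?_, fun i j hij hf => ?_⟩
  · have := Equiv.ofFiberEquiv_map (f := f) (g := g) (fun x => (e x).toEquiv)
      ((Equiv.ofFiberEquiv fun x => (e x).toEquiv).symm i)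
    rw [Equiv.apply_symm_apply] at this
    exact this.symm
  · rw [hval i _ hf, hval j _ rfl]
    exact (e (f j)).strictMono (a := ⟨i, hf⟩) (b := ⟨j, rfl⟩) hij

/-! ### Positions between consecutive parts -/

section

variable {n : ℕ} {α γ : Composition n}

theorem sizeUpTo_lt {i j : ℕ} (hij : i < j) (hj : j ≤ α.length) :
    α.sizeUpTo i < α.sizeUpTo j :=
  (α.sizeUpTo_strict_mono (by omega)).trans_le (α.monotone_sizeUpTo hij)

theorem sizeUpTo_inj {i j : ℕ} (hi : i ≤ α.length) (hj : j ≤ α.length)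
    (h : α.sizeUpTo i = α.sizeUpTo j) : i = j := by
  rcases lt_trichotomy i j with h1 | h1 | h1
  · exact absurd h (sizeUpTo_lt h1 hj).ne
  · exact h1
  · exact absurd h (sizeUpTo_lt h1 hi).ne'

theorem sizeUpTo_eq_sum {t : ℕ} : α.sizeUpTo t = ∑ i : Fin α.length with i.val < t,
    α.blocksFun i := by
  rw [← List.sum_take_ofFn, α.ofFn_blocksFun]; rfl

theorem sizeUpTo_pos {i j : Fin α.length} (h : (j : ℕ) = i + 1) : 0 < α.sizeUpTo j := by
  have := sizeUpTo_lt (α := α) (i := 0) (j := j) (by omega) (by omega)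
  omega

theorem sizeUpTo_lt_self (j : Fin α.length) : α.sizeUpTo j < n := by
  have := sizeUpTo_lt (α := α) (i := j) (j := α.length) (by omega) le_rfl
  rwa [α.sizeUpTo_length] at this

theorem isStepSum_blocks_iff {r : ℕ → ℕ → Prop} {q : ℕ} :
    IsStepSum r α.blocks q ↔ ∃ i j : Fin α.length, (j : ℕ) = i + 1 ∧
      r (α.blocksFun i) (α.blocksFun j) ∧ α.sizeUpTo j = q := by
  constructor
  · rintro ⟨i, h, hr, rfl⟩
    exact ⟨⟨i, by change _ < α.blocks.length; omega⟩, ⟨i + 1, h⟩, rfl, hr, rfl⟩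
  · rintro ⟨⟨i, hi⟩, ⟨j, hj⟩, rfl, hr, rfl⟩
    exact ⟨i, hj, hr, rfl⟩

theorem mem_cuts_iff {q : Fin (n - 1)} :
    q ∈ cuts α ↔ ∃ i j : Fin α.length, (j : ℕ) = i + 1 ∧ α.sizeUpTo j = q + 1 := by
  rw [mem_cuts]
  constructor
  · rintro ⟨m, hm⟩
    change α.sizeUpTo m = q + 1 at hm
    have h0 : m ≠ 0 := by rintro rfl; simp at hm
    have h1 : m < α.length := by
      by_contra h
      rw [α.sizeUpTo_ofLength_le m (by omega)] at hm
      omega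
    exact ⟨⟨m - 1, by omega⟩, ⟨m, h1⟩, by simp; omega, hm⟩
  · rintro ⟨i, j, -, h⟩
    exact ⟨j, h⟩

theorem subset_cuts_iff_forall {S : Finset (Fin (n - 1))} {p : Fin α.length → Fin α.length → Prop}
    (hS : ∀ q, q ∈ S ↔ ∃ i j : Fin α.length, ((j : ℕ) = i + 1 ∧ p i j) ∧ α.sizeUpTo j = q + 1) :
    S ⊆ cuts γ ↔ ∀ i j : Fin α.length, (j : ℕ) = i + 1 → p i j →
      α.sizeUpTo j ∈ partialSums γ.blocks := by
  constructor
  · intro h i j hij hp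
    have h0 := sizeUpTo_pos hij
    have h1 := sizeUpTo_lt_self j
    have := h ((hS ⟨α.sizeUpTo j - 1, by omega⟩).2 ⟨i, j, ⟨hij, hp⟩, by simp; omega⟩)
    rw [mem_cuts] at this
    simpa [Nat.sub_add_cancel h0] using this
  · intro h q hq
    obtain ⟨i, j, ⟨hij, hp⟩, hj⟩ := (hS q).1 hq
    rw [mem_cuts, ← hj]
    exact h i j hij hp

/-! ### Column sums of strict diagonal fillings -/

theorem partialSums_filter_pos (l : List ℕ) :
    partialSums (l.filter fun s => decide (0 < s)) = partialSums l := by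
  induction l with
  | nil => rfl
  | cons a l ih =>
    ext q
    rcases Nat.eq_zero_or_pos a with rfl | ha
    · rw [List.filter_cons_of_neg (by simp), ih, mem_partialSums_cons]
      constructor
      · exact fun h => Or.inr ⟨q, h, by simp⟩
      · rintro (rfl | ⟨s, hs, rfl⟩)
        · exact zero_mem_partialSums _
        · simpa using hs
    · rw [List.filter_cons_of_pos (by simpa using ha), mem_partialSums_cons, ih,
        mem_partialSums_cons]

theorem mem_partialSums_colSum {c : Fin α.length → Fin α.length} {q : ℕ} :
    q ∈ partialSums (colSum α c).blocks ↔
      ∃ m, ∑ i with (c i : ℕ) < m, α.blocksFun i = q := by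
  simp only [colSum, partialSums_filter_pos]
  change (∃ m, _) ↔ _
  refine exists_congr fun m => ?_
  rw [List.sum_take_ofFn]
  have : ∑ j : Fin α.length with j.val < m, ∑ i with c i = j, α.blocksFun i =
      ∑ i with (c i : ℕ) < m, α.blocksFun i := by
    rw [Finset.sum_comm' (t' := {i | (c i : ℕ) < m}) (s' := fun i => {c i})]
    · simp
    · simp only [Finset.mem_filter, Finset.mem_univ, true_and, Finset.mem_singleton]
      intro x y
      constructor
      · rintro ⟨h, rfl⟩; exact ⟨rfl, h⟩
      · rintro ⟨rfl, h⟩; exact ⟨h, rfl⟩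
  rw [this]

theorem colSum_comp_perm (c : Fin α.length → Fin α.length) (σ : Equiv.Perm (Fin α.length))
    (hσ : ∀ i, α.blocksFun (σ i) = α.blocksFun i) : colSum α (c ∘ σ) = colSum α c := by
  have : ∀ j, ∑ i with (c ∘ σ) i = j, α.blocksFun i = ∑ i with c i = j, α.blocksFun i := by
    intro j
    rw [Finset.sum_filter, Finset.sum_filter, ← Equiv.sum_comp σ fun i => if c i = j then _ else 0]
    simp [hσ]
  ext1
  simp only [colSum, this]

theorem IsStrictDiagonal.monotone {d : Fin α.length → Fin α.length}
    (hd : IsStrictDiagonal α d) : Monotone d := by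
  have h : ∀ t : ℕ, ∀ i j : Fin α.length, (j : ℕ) = i + t → d i ≤ d j := by
    intro t
    induction t with
    | zero => intro i j h; rw [Fin.ext (a := i) (b := j) (by omega)]
    | succ t ih =>
      intro i j h
      refine (ih i ⟨i + t, by omega⟩ rfl).trans ?_
      rcases hd.2 ⟨i + t, by omega⟩ j (by simp; omega) with h1 | ⟨-, h1⟩
      · exact Fin.le_def.2 (by omega)
      · exact h1.ge
  intro i j hij
  exact h (j - i) i j (by have := Fin.le_def.1 hij; omega)

/-- Since `d` is monotone, the entries in the first columns form an initial segment of `α`; the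
proper nonzero partial sums are the positions where the column changes. -/
theorem IsStrictDiagonal.mem_partialSums_colSum_iff {d : Fin α.length → Fin α.length}
    (hd : IsStrictDiagonal α d) {q : ℕ} :
    q ∈ partialSums (colSum α d).blocks ↔ q = 0 ∨ q = n ∨
      ∃ i j : Fin α.length, (j : ℕ) = i + 1 ∧ d i < d j ∧ α.sizeUpTo j = q := by
  constructor
  · rw [mem_partialSums_colSum]
    rintro ⟨m, rfl⟩
    -- `t` is the first row whose column is at least `m`, or the number of rows if there is none.
    obtain ⟨t, ht, hdt⟩ : ∃ t ≤ α.length, ∀ i : Fin α.length, (d i : ℕ) < m ↔ (i : ℕ) < t := by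
      by_cases h : ∃ t, ∃ h : t < α.length, ¬ (d ⟨t, h⟩ : ℕ) < m
      · classical
        obtain ⟨h1, h2⟩ := Nat.find_spec h
        refine ⟨Nat.find h, h1.le, fun i => ⟨fun hi => ?_, fun hi => ?_⟩⟩
        · by_contra h3
          have := Fin.le_def.1 (hd.monotone (Fin.le_def.2 (not_lt.1 h3) : ⟨Nat.find h, h1⟩ ≤ i))
          omega
        · by_contra h3
          exact Nat.find_min h hi ⟨i.2, h3⟩
      · push Not at h
        exact ⟨α.length, le_rfl, fun i => by simp [h i i.2]⟩
    simp only [hdt, ← sizeUpTo_eq_sum]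
    rcases Nat.eq_zero_or_pos t with rfl | h0
    · simp
    rcases ht.eq_or_lt with rfl | h1
    · simp
    · refine Or.inr (Or.inr ⟨⟨t - 1, by omega⟩, ⟨t, h1⟩, by simp; omega, ?_, rfl⟩)
      have h2 := (hdt ⟨t - 1, by omega⟩).2 (by simp; omega)
      have h3 := (hdt ⟨t, h1⟩).not.2 (by simp)
      exact Fin.lt_def.2 (by omega)
  · rintro (rfl | rfl | ⟨i, j, hij, hlt, rfl⟩)
    · exact zero_mem_partialSums _
    · exact self_mem_partialSums _
    · rw [mem_partialSums_colSum]
      refine ⟨d j, ?_⟩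
      rw [sizeUpTo_eq_sum]
      congr 1
      ext l
      simp only [Finset.mem_filter, Finset.mem_univ, true_and]
      constructor
      · intro h
        by_contra h'
        have := Fin.le_def.1 (hd.monotone (Fin.le_def.2 (not_lt.1 h')))
        omega
      · intro h
        have := Fin.le_def.1 (hd.monotone (Fin.le_def.2 (by omega : (l : ℕ) ≤ i)))
        have := Fin.lt_def.1 hlt
        omega

theorem IsStrictDiagonal.colSum_eq_iff {d : Fin α.length → Fin α.length}
    (hd : IsStrictDiagonal α d) :
    colSum α d = γ ↔ cuts γ ⊆ cuts α ∧ ∀ i j : Fin α.length, (j : ℕ) = i + 1 →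
      (d i < d j ↔ α.sizeUpTo j ∈ partialSums γ.blocks) := by
  constructor
  · rintro rfl
    constructor
    · intro q hq
      rw [mem_cuts, hd.mem_partialSums_colSum_iff] at hq
      rcases hq with h | h | ⟨i, j, hij, -, h⟩
      · omega
      · omega
      · exact mem_cuts_iff.2 ⟨i, j, hij, h⟩
    · intro i j hij
      rw [hd.mem_partialSums_colSum_iff]
      constructor
      · exact fun h => Or.inr (Or.inr ⟨i, j, hij, h, rfl⟩)
      · rintro (h | h | ⟨i', j', hij', h, he⟩)
        · exact absurd h (sizeUpTo_pos hij).ne'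
        · exact absurd h (sizeUpTo_lt_self j).ne
        · have h1 : j' = j := Fin.ext (sizeUpTo_inj j'.2.le j.2.le he)
          subst h1
          obtain rfl : i' = i := Fin.ext (by omega)
          exact h
  · rintro ⟨h1, h2⟩
    apply cuts.injective
    ext q
    constructor
    · intro hq
      rw [mem_cuts, hd.mem_partialSums_colSum_iff] at hq
      rcases hq with h | h | ⟨i, j, hij, hlt, h⟩
      · omega
      · omega
      · rw [mem_cuts, ← h]
        exact (h2 i j hij).1 hlt
    · intro hq
      obtain ⟨i, j, hij, h⟩ := mem_cuts_iff.1 (h1 hq)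
      rw [mem_cuts, ← h] at hq ⊢
      exact hd.mem_partialSums_colSum_iff.2 (Or.inr (Or.inr ⟨i, j, hij, (h2 i j hij).2 hq, rfl⟩))

/-- The column of a row is the number of cuts of `γ` met at the starts of the rows up to it, the top
row excluded. Without a cut the column does not change; this is allowed because the hypothesis rules
out an ascent there. -/
theorem exists_isStrictDiagonal (h : ∀ i j : Fin α.length, (j : ℕ) = i + 1 →
      α.blocksFun i < α.blocksFun j → α.sizeUpTo j ∈ partialSums γ.blocks) :
    ∃ d, IsStrictDiagonal α d ∧ ∀ i j : Fin α.length, (j : ℕ) = i + 1 →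
      (d i < d j ↔ α.sizeUpTo j ∈ partialSums γ.blocks) := by
  classical
  let D : ℕ → ℕ := fun i => ((Finset.Ioc 0 i).filter
    fun l => α.sizeUpTo l ∈ partialSums γ.blocks).card
  have hD : ∀ i, D (i + 1) = D i + if α.sizeUpTo (i + 1) ∈ partialSums γ.blocks then 1 else 0 := by
    intro i
    have : Finset.Ioc 0 (i + 1) = insert (i + 1) (Finset.Ioc 0 i) := by
      ext; simp; omega
    simp only [D, this, Finset.filter_insert]
    split
    · rw [Finset.card_insert_of_notMem (by simp)]
    · rfl
  have hle : ∀ i, D i ≤ i := fun i => (Finset.card_filter_le _ _).trans (by simp)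
  refine ⟨fun i => ⟨D i, (hle i).trans_lt i.2⟩, ⟨fun i hi => by simp [hi, D], ?_⟩, ?_⟩
  · intro i j hij
    have := hD i
    rw [← hij] at this
    by_cases hc : α.sizeUpTo j ∈ partialSums γ.blocks
    · left; simpa [hc] using this
    · right
      exact ⟨not_lt.1 fun h' => hc (h i j hij h'), Fin.ext (by simpa [hc] using this)⟩
  · intro i j hij
    have := hD i
    rw [← hij] at this
    rw [Fin.lt_def]
    simp only [this]
    split <;> simp_all

/-- The column sums determine where the column changes, and each change is by exactly one. -/
theorem IsStrictDiagonal.eq_of_colSum_eq {d d' : Fin α.length → Fin α.length}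
    (hd : IsStrictDiagonal α d) (hd' : IsStrictDiagonal α d') (h : colSum α d = colSum α d') :
    d = d' := by
  have h1 := (hd.colSum_eq_iff.1 h).2
  have h2 := (hd'.colSum_eq_iff.1 rfl).2
  have key : ∀ t : ℕ, ∀ ht : t < α.length, d ⟨t, ht⟩ = d' ⟨t, ht⟩ := by
    intro t
    induction t with
    | zero => intro ht; exact Fin.ext (by rw [hd.1 _ rfl, hd'.1 _ rfl])
    | succ t ih =>
      intro ht
      have h3 := ih (by omega)
      have h4 := (h1 ⟨t, by omega⟩ ⟨t + 1, ht⟩ rfl).trans (h2 ⟨t, by omega⟩ ⟨t + 1, ht⟩ rfl).symm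
      have h5 := hd.2 ⟨t, by omega⟩ ⟨t + 1, ht⟩ rfl
      have h6 := hd'.2 ⟨t, by omega⟩ ⟨t + 1, ht⟩ rfl
      rw [Fin.lt_def, Fin.lt_def] at h4
      rw [Fin.ext_iff] at h3 h5 h6 ⊢
      omega
  funext i
  exact key i i.2

/-! ### Fillings with given column sums and permutations of rows -/

/-- The permutations of the rows of the fillings of `α` that preserve the parts. -/
abbrev RowPerm (α : Composition n) : Type :=
  {σ : Equiv.Perm (Fin α.length) // ∀ i, α.blocksFun (σ i) = α.blocksFun i}

theorem RowPerm.blocksFun_symm (σ : RowPerm α) (i : Fin α.length) :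
    α.blocksFun (σ.1.symm i) = α.blocksFun i := by
  rw [← σ.2, Equiv.apply_symm_apply]

/-- The consecutive parts in the rows `i` and `j` increase weakly, and, if they are equal, the
permutation `σ` has a descent there. -/
def IsMarked (α : Composition n) (σ : RowPerm α) (i j : Fin α.length) : Prop :=
  α.blocksFun i < α.blocksFun j ∨ (α.blocksFun i = α.blocksFun j ∧ σ.1 j < σ.1 i)

open Classical in
/-- The positions between consecutive parts that are marked by `σ`. -/
noncomputable def markedCuts (α : Composition n) (σ : RowPerm α) : Finset (Fin (n - 1)) :=
  {q | ∃ i j : Fin α.length, ((j : ℕ) = i + 1 ∧ IsMarked α σ i j) ∧ α.sizeUpTo j = q + 1}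

theorem mem_markedCuts {σ : RowPerm α} {q : Fin (n - 1)} : q ∈ markedCuts α σ ↔
    ∃ i j : Fin α.length, ((j : ℕ) = i + 1 ∧ IsMarked α σ i j) ∧ α.sizeUpTo j = q + 1 := by
  simp [markedCuts]

theorem markedCuts_subset_iff {σ : RowPerm α} :
    markedCuts α σ ⊆ cuts γ ↔ ∀ i j : Fin α.length, (j : ℕ) = i + 1 → IsMarked α σ i j →
      α.sizeUpTo j ∈ partialSums γ.blocks :=
  subset_cuts_iff_forall fun _ => mem_markedCuts

/-- Parts decrease weakly within a column, so equal parts in one column fill consecutive rows. A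
descent of `σ` between two adjacent ones would be marked, hence a cut, and would force a change of
column. -/
theorem IsStrictDiagonal.increasing_on_fibers {d : Fin α.length → Fin α.length}
    (hd : IsStrictDiagonal α d) {σ : RowPerm α} (hσ : markedCuts α σ ⊆ cuts (colSum α d))
    (i j : Fin α.length) (hij : i < j) (hf : (α.blocksFun i, d i) = (α.blocksFun j, d j)) :
    σ.1 i < σ.1 j := by
  rw [markedCuts_subset_iff] at hσ
  have h2 := (hd.colSum_eq_iff.1 rfl).2
  have anti : ∀ t : ℕ, ∀ i j : Fin α.length, (j : ℕ) = i + t → d i = d j →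
      α.blocksFun j ≤ α.blocksFun i := by
    intro t
    induction t with
    | zero => intro i j h _; rw [Fin.ext (a := i) (b := j) (by omega)]
    | succ t ih =>
      intro i j h he
      let l : Fin α.length := ⟨i + t, by omega⟩
      have hil : d i ≤ d l := hd.monotone (Fin.le_def.2 (by simp [l]))
      have hlj : d l ≤ d j := hd.monotone (Fin.le_def.2 (by simp [l]; omega))
      have hi : d i = d l := le_antisymm hil (he ▸ hlj)
      rcases hd.2 l j (by simp [l]; omega) with h3 | ⟨h3, -⟩
      · rw [← he, ← hi] at h3; omega
      · exact h3.trans (ih i l rfl hi)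
  have key : ∀ t : ℕ, ∀ i j : Fin α.length, (j : ℕ) = i + 1 + t → d i = d j →
      α.blocksFun i = α.blocksFun j → σ.1 i < σ.1 j := by
    intro t
    have base : ∀ i j : Fin α.length, (j : ℕ) = i + 1 → d i = d j →
        α.blocksFun i = α.blocksFun j → σ.1 i < σ.1 j := by
      intro i j h he ha
      by_contra hlt
      rcases (not_lt.1 hlt).lt_or_eq with h3 | h3
      · exact ((h2 i j h).2 (hσ i j h (Or.inr ⟨ha, h3⟩))).ne he
      · have := congrArg Fin.val (σ.1.injective h3)
        omega
    induction t with
    | zero => exact base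
    | succ t ih =>
      intro i j h he ha
      let l : Fin α.length := ⟨i + 1 + t, by omega⟩
      have hil : d i ≤ d l := hd.monotone (Fin.le_def.2 (by simp [l]; omega))
      have hlj : d l ≤ d j := hd.monotone (Fin.le_def.2 (by simp [l]; omega))
      have hi : d i = d l := le_antisymm hil (he ▸ hlj)
      have h3 := anti (t + 1) i l (by simp [l]; omega) hi
      have h4 := anti 1 l j (by simp [l]; omega) (hi ▸ he)
      have h5 : α.blocksFun i = α.blocksFun l := le_antisymm (ha ▸ h4) h3
      exact (ih i l rfl hi h5).trans (base l j (by simp [l]; omega) (hi ▸ he) (h5 ▸ ha))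
  simp only [Prod.mk.injEq] at hf
  exact key (j - i - 1) i j (by have := Fin.lt_def.1 hij; omega) hf.2 hf.1

/-- Permuting equal parts preserves column sums, so all fillings counted come from the unique strict
diagonal `d` with sums `γ`. Each is `d ∘ σ⁻¹` for exactly one `σ` increasing on the fibres of (part,
column), and this is the condition on marked cuts. -/
theorem card_filter_DD_colSum (α γ : Composition n) :
    ((DD α).filter fun c => colSum α c = γ).card =
      ((Finset.univ : Finset (RowPerm α)).filter fun σ =>
        markedCuts α σ ⊆ cuts γ ∧ cuts γ ⊆ cuts α).card := by
  by_cases hex : ∃ d, IsStrictDiagonal α d ∧ colSum α d = γ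
  · obtain ⟨d, hd, rfl⟩ := hex
    symm
    refine Finset.card_bij (fun σ _ => d ∘ σ.1.symm) ?_ ?_ ?_
    · intro σ hσ
      simp only [DD, Finset.mem_filter, Finset.mem_univ, true_and]
      refine ⟨⟨σ.1, σ.2, ?_⟩, colSum_comp_perm d σ.1.symm σ.blocksFun_symm⟩
      rw [Function.comp_assoc]
      simpa using hd
    · intro σ hσ τ hτ h
      simp only [Finset.mem_filter, Finset.mem_univ, true_and] at hσ hτ
      refine Subtype.ext (perm_eq_of_increasing_on_fibers (fun i => (α.blocksFun i, d i)) ?_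
        (hd.increasing_on_fibers hσ.1) (hd.increasing_on_fibers hτ.1))
      intro i
      have := congrFun h i
      simp only [Function.comp_apply] at this
      rw [σ.blocksFun_symm, τ.blocksFun_symm, this]
    · intro c hc
      simp only [DD, Finset.mem_filter, Finset.mem_univ, true_and] at hc
      obtain ⟨⟨τ, hτ, hd'⟩, hcol⟩ := hc
      have hdc : c ∘ τ = d := hd'.eq_of_colSum_eq hd ((colSum_comp_perm c τ hτ).trans hcol)
      obtain ⟨σ, hσ, hinc⟩ := exists_perm_increasing_on_fibers
        (fun i => (α.blocksFun i, d i)) τ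
      simp only [Prod.mk.injEq] at hσ hinc
      have hpres : ∀ i, α.blocksFun (σ i) = α.blocksFun i := by
        intro i
        have := (hσ (σ i)).1
        rw [Equiv.symm_apply_apply, RowPerm.blocksFun_symm ⟨τ, hτ⟩] at this
        exact this.symm
      refine ⟨⟨σ, hpres⟩, ?_, ?_⟩
      · simp only [Finset.mem_filter, Finset.mem_univ, true_and]
        have h3 := hd.colSum_eq_iff.1 rfl
        refine ⟨markedCuts_subset_iff.2 fun i j hij hm => (h3.2 i j hij).1 ?_, h3.1⟩
        rcases hd.2 i j hij with h4 | ⟨h4, h5⟩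
        · exact Fin.lt_def.2 (by omega)
        · rcases hm with hm | ⟨hm, hlt⟩
          · omega
          · exact absurd (hinc i j (Fin.lt_def.2 (by omega)) ⟨hm, h5.symm⟩) (lt_asymm hlt)
      · funext i
        simp only [Function.comp_apply, (hσ i).2]
        rw [← hdc]
        simp
  -- Without such a `d` both sets are empty: marked cuts contain all ascents, so an admissible `σ`
  -- would produce a `d`.
  · rw [Finset.filter_false_of_mem, Finset.filter_false_of_mem]
    · rfl
    · rintro σ - ⟨h1, h2⟩
      rw [markedCuts_subset_iff] at h1
      obtain ⟨d, hd, h3⟩ := exists_isStrictDiagonal fun i j hij h => h1 i j hij (Or.inl h)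
      exact hex ⟨d, hd, hd.colSum_eq_iff.2 ⟨h2, h3⟩⟩
    · intro c hc h
      simp only [DD, Finset.mem_filter, Finset.mem_univ, true_and] at hc
      obtain ⟨τ, hτ, hd⟩ := hc
      exact hex ⟨_, hd, (colSum_comp_perm c τ hτ).trans h⟩

end

/-! ### The rows of a ribbon -/

theorem length_ribbonAt (l : List ℕ) (x : ℕ × ℕ) : (ribbonAt x l).length = l.sum := by
  induction l generalizing x with
  | nil => rfl
  | cons b l ih => simp [ribbonAt, ih]

theorem getD_ribbonAt_zero {l : List ℕ} (hl : ∀ i ∈ l, 0 < i) (h : l ≠ []) (x d : ℕ × ℕ) :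
    (ribbonAt x l).getD 0 d = x := by
  cases l with
  | nil => exact absurd rfl h
  | cons b l =>
    have hb := hl b (by simp)
    rw [ribbonAt, List.getD_append _ _ _ _ (by simpa using hb)]
    simp [hb]

theorem exists_drop_ribbonAt (l : List ℕ) (j : ℕ) (x : ℕ × ℕ) :
    ∃ y, (ribbonAt x l).drop (l.take j).sum = ribbonAt y (l.drop j) := by
  induction l generalizing j x with
  | nil => exact ⟨x, by simp [ribbonAt]⟩
  | cons b l ih =>
    cases j with
    | zero => exact ⟨x, by simp⟩
    | succ j =>
      obtain ⟨y, hy⟩ := ih j (x.1 + 1, x.2 + b - 1)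
      refine ⟨y, ?_⟩
      rw [List.drop_succ_cons, ← hy, ribbonAt, List.take_succ_cons, List.sum_cons,
        ← List.drop_drop, List.drop_left' (by simp)]

/-- This translates the test for a southward step: comparing lengths shows that the number of
removed boxes must be a partial sum of `l`. -/
theorem exists_ribbonAt_drop_iff {l : List ℕ} (hl : ∀ i ∈ l, 0 < i) {x : ℕ × ℕ} {p : ℕ}
    (hp : p < l.sum) :
    (∃ j < l.length, ribbonAt (((ribbonAt x l).drop p).headD (0, 0)) (l.drop j) =
      (ribbonAt x l).drop p) ↔ p ∈ partialSums l := by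
  constructor
  · rintro ⟨j, -, h⟩
    refine ⟨j, ?_⟩
    have h1 := congrArg List.length h
    rw [length_ribbonAt, List.length_drop, length_ribbonAt] at h1
    have h2 := List.sum_take_add_sum_drop l j
    omega
  · rintro ⟨j, rfl⟩
    have hj : j < l.length := by
      by_contra hj
      rw [List.take_of_length_le (not_lt.1 hj)] at hp
      exact hp.false
    refine ⟨j, hj, ?_⟩
    obtain ⟨y, hy⟩ := exists_drop_ribbonAt l j x
    rw [hy]
    congr 1
    have := getD_ribbonAt_zero (fun i hi => hl i (List.mem_of_mem_drop hi))
      (show l.drop j ≠ [] by simpa using hj) y (0, 0)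
    rwa [List.getD_eq_getElem?_getD, ← List.head?_eq_getElem?, ← List.headD_eq_head?_getD] at this

open Classical in
theorem getD_ribbonAt_succ_fst {l : List ℕ} (hl : ∀ i ∈ l, 0 < i) (x d : ℕ × ℕ) {t : ℕ}
    (ht : t + 1 < l.sum) :
    ((ribbonAt x l).getD (t + 1) d).1 =
      ((ribbonAt x l).getD t d).1 + if t + 1 ∈ partialSums l then 1 else 0 := by
  induction l generalizing x t with
  | nil => simp at ht
  | cons b l ih =>
    have hl' : ∀ i ∈ l, 0 < i := fun i hi => hl i (by simp [hi])
    rw [List.sum_cons] at ht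
    simp only [ribbonAt, mem_partialSums_cons]
    rcases lt_trichotomy (t + 1) b with h | h | h
    · rw [List.getD_append _ _ _ _ (by simpa using h),
        List.getD_append _ _ _ _ (by simp; omega), if_neg]
      · simp [h, show t < b by omega]
      · rintro (h' | ⟨s, -, h'⟩) <;> omega
    · have hne : l ≠ [] := by rintro rfl; simp at ht; omega
      rw [List.getD_append_right _ _ _ _ (by simp; omega),
        List.getD_append _ _ _ _ (by simp; omega), if_pos (Or.inr ⟨0, zero_mem_partialSums _, h⟩)]
      simp only [List.length_map, List.length_range, h, Nat.sub_self]
      rw [getD_ribbonAt_zero hl' hne]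
      simp [show t < b by omega]
    · rw [List.getD_append_right _ _ _ _ (by simp; omega),
        List.getD_append_right _ _ _ _ (by simp; omega)]
      simp only [List.length_map, List.length_range]
      rw [show t + 1 - b = t - b + 1 by omega, ih hl' _ (by omega)]
      congr 2
      rw [eq_iff_iff]
      constructor
      · exact fun h' => Or.inr ⟨_, h', by omega⟩
      · rintro (h' | ⟨s, hs, h'⟩)
        · omega
        · rwa [show t - b + 1 = s by omega]

open Classical in
-- A function growing by unit steps takes one value more than it has steps. The second conclusion
-- serves the induction: it shows that the value after a step is new.
theorem card_image_Ico_of_step (f : ℕ → ℕ) (S : Set ℕ) (p a : ℕ)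
    (h : ∀ t, p ≤ t → t < p + a → f (t + 1) = f t + if t + 1 ∈ S then 1 else 0) :
    ((Finset.Ico p (p + a + 1)).image f).card =
      ((Finset.Ioo p (p + a + 1)).filter (· ∈ S)).card + 1 ∧
    ∀ t, p ≤ t → t ≤ p + a → f t ≤ f (p + a) := by
  induction a with
  | zero =>
    have : Finset.Ioo p (p + 0 + 1) = ∅ := by ext; simp
    refine ⟨by simp [this], fun t h1 h2 => ?_⟩
    obtain rfl : t = p := by omega
    rfl
  | succ a ih =>
    obtain ⟨ih1, ih2⟩ := ih fun t h1 h2 => h t h1 (by omega)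
    have hs := h (p + a) (by omega) (by omega)
    rw [show p + (a + 1) = p + a + 1 by omega]
    have e1 : Finset.Ico p (p + a + 1 + 1) = insert (p + a + 1) (Finset.Ico p (p + a + 1)) := by
      ext; simp; omega
    have e2 : Finset.Ioo p (p + a + 1 + 1) = insert (p + a + 1) (Finset.Ioo p (p + a + 1)) := by
      ext; simp
    constructor
    · rw [e1, e2, Finset.image_insert, Finset.filter_insert]
      split_ifs with hS
      · rw [if_pos hS] at hs
        rw [Finset.card_insert_of_notMem, Finset.card_insert_of_notMem, ih1]
        · simp
        · simp only [Finset.mem_image, Finset.mem_Ico, not_exists, not_and]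
          intro t ht he
          have := ih2 t ht.1 (by omega)
          omega
      · rw [if_neg hS] at hs
        rw [Finset.insert_eq_of_mem, ih1]
        exact Finset.mem_image.2 ⟨p + a, by simp, by omega⟩
    · intro t h1 h2
      rcases h2.lt_or_eq with h3 | rfl
      · have := ih2 t h1 (by omega)
        omega
      · rfl

open Classical in
theorem height_take_drop_ribbonAt {l : List ℕ} (hl : ∀ i ∈ l, 0 < i) (x : ℕ × ℕ) {p a : ℕ}
    (ha : 0 < a) (hp : p + a ≤ l.sum) :
    height (((ribbonAt x l).drop p).take a) =
      ((Finset.Ioo p (p + a)).filter (· ∈ partialSums l)).card + 1 := by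
  obtain ⟨a, rfl⟩ : ∃ b, a = b + 1 := ⟨a - 1, by omega⟩
  have h1 := (card_image_Ico_of_step (fun t => ((ribbonAt x l).getD t (0, 0)).1) (partialSums l) p a
    fun t h1 h2 => getD_ribbonAt_succ_fst hl _ _ (by omega)).1
  rw [← add_assoc, ← h1, height]
  congr 1
  ext r
  have hlen := length_ribbonAt l x
  simp only [List.mem_toFinset, List.mem_map, Finset.mem_image, Finset.mem_Ico]
  constructor
  · rintro ⟨y, hy, rfl⟩
    obtain ⟨i, hi, rfl⟩ := List.mem_iff_getElem.1 hy
    simp only [List.length_take, List.length_drop] at hi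
    refine ⟨p + i, by omega, ?_⟩
    rw [List.getD_eq_getElem _ _ (by omega)]
    simp
  · rintro ⟨t, ht, rfl⟩
    refine ⟨(ribbonAt x l).getD t (0, 0), List.mem_iff_getElem.2 ⟨t - p, ?_, ?_⟩, rfl⟩
    · simp; omega
    · rw [List.getD_eq_getElem _ _ (by omega)]
      simp [show p + (t - p) = t by omega]

/-! ### The height computed by the algorithm -/

open Classical in
-- With `p` boxes already removed, the pass for a part `a` adds the number of cuts of `l` strictly
-- between `p` and `p + a`. The endpoints never count, so exactly the cuts that are not partial sums
-- of the parts are counted.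
theorem ht_loop {n : ℕ} {l : List ℕ} (hl : ∀ i ∈ l, 0 < i) (x : ℕ × ℕ) {as : List ℕ}
    (has : ∀ a ∈ as, 0 < a) {p : ℕ} (hp : p + as.sum ≤ l.sum) (prev : Option ℕ) (s : State n)
    (hs : s.R = (ribbonAt x l).drop p) :
    (loop l prev as s).ht = s.ht + ((Finset.Ioo p (p + as.sum)).filter fun q =>
      q ∈ partialSums l ∧ q - p ∉ partialSums as).card := by
  induction as generalizing p prev s with
  | nil => simp [loop]
  | cons a as ih =>
    have ha := has a (by simp)
    rw [List.sum_cons] at hp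
    rw [loop, ih (p := p + a) (fun i hi => has i (by simp [hi])) (by omega) _ _
      (by simp [step, hs, List.drop_drop])]
    simp only [step, hs, List.sum_cons]
    -- The height is one more than the number of cuts, so the truncated subtraction is exact.
    rw [height_take_drop_ribbonAt hl x ha (by omega), ← Nat.add_assoc, Nat.add_sub_cancel,
      add_assoc, ← Finset.card_union_of_disjoint]
    · congr 2
      ext q
      simp only [Finset.mem_union, Finset.mem_filter, Finset.mem_Ioo, mem_partialSums_cons]
      constructor
      · rintro (⟨h1, h2⟩ | ⟨h1, h2, h3⟩)
        · refine ⟨by omega, h2, ?_⟩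
          rintro (h | ⟨t, -, h⟩) <;> omega
        · refine ⟨by omega, h2, ?_⟩
          rintro (h | ⟨t, ht, h⟩)
          · omega
          · exact h3 (by rwa [show q - (p + a) = t by omega])
      · rintro ⟨h1, h2, h3⟩
        rcases lt_trichotomy q (p + a) with h | h | h
        · exact Or.inl ⟨by omega, h2⟩
        · exact absurd (Or.inr ⟨0, zero_mem_partialSums _, by omega⟩) h3
        · exact Or.inr ⟨by omega, h2, fun h4 => h3 (Or.inr ⟨_, h4, by omega⟩)⟩
    · rw [Finset.disjoint_left]
      intro q hq hq'
      simp only [Finset.mem_filter, Finset.mem_Ioo] at hq hq'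
      omega

theorem ht_eq_card {n : ℕ} (β α : Composition n) : ht β α = (cuts β \ cuts α).card := by
  classical
  rw [ht, descentRibbons, ht_loop (fun i hi => β.blocks_pos hi) (0, 0)
    (fun i hi => α.blocks_pos hi) (p := 0) (by simp) _ _ (by simp), zero_add]
  symm
  refine Finset.card_bij (fun j _ => (j : ℕ) + 1) ?_ ?_ ?_
  · intro j hj
    simp only [Finset.mem_sdiff, mem_cuts] at hj
    simp only [Finset.mem_filter, Finset.mem_Ioo, α.blocks_sum]
    exact ⟨by omega, hj⟩
  · intro i _ j _ h
    exact Fin.ext (by omega)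
  · intro q hq
    simp only [Finset.mem_filter, Finset.mem_Ioo, α.blocks_sum] at hq
    refine ⟨⟨q - 1, by omega⟩, ?_, by simp; omega⟩
    simp only [Finset.mem_sdiff, mem_cuts, Nat.sub_add_cancel hq.1.1]
    exact hq.2

/-! ### The ribbons computed by the algorithm -/

/-- The ribbon whose successive boxes differ by the entries of `ds` (the first one is ignored). -/
def ribbonOfSteps (ds : List (ℕ × ℕ)) : List (ℕ × ℕ) := ds.foldl extend []

theorem ribbonOfSteps_append_singleton (ds : List (ℕ × ℕ)) (d : ℕ × ℕ) :
    ribbonOfSteps (ds ++ [d]) = extend (ribbonOfSteps ds) d := by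
  simp [ribbonOfSteps]

theorem length_ribbonOfSteps (ds : List (ℕ × ℕ)) : (ribbonOfSteps ds).length = ds.length := by
  induction ds using List.reverseRecOn with
  | nil => rfl
  | append_singleton ds d ih => simp [ribbonOfSteps_append_singleton, extend, ih]

theorem getElem_ribbonOfSteps_succ (ds : List (ℕ × ℕ)) {t : ℕ} (h : t + 1 < ds.length) :
    (ribbonOfSteps ds)[t + 1]'(by rwa [length_ribbonOfSteps]) =
      (ribbonOfSteps ds)[t]'(by rw [length_ribbonOfSteps]; omega) + ds[t + 1] := by
  induction ds using List.reverseRecOn with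
  | nil => simp at h
  | append_singleton ds d ih =>
    have hlen := length_ribbonOfSteps ds
    simp only [ribbonOfSteps_append_singleton, extend]
    rw [List.length_append, List.length_singleton] at h
    rcases Nat.lt_or_ge (t + 1) ds.length with h1 | h1
    · rw [List.getElem_append_left (by omega), List.getElem_append_left (by omega),
        List.getElem_append_left h1, ih h1]
    · have h2 : t + 1 = ds.length := by omega
      rw [List.getElem_append_right (by omega), List.getElem_append_left (by omega),
        List.getElem_append_right (by omega)]
      have : (ribbonOfSteps ds).getLast? = some ((ribbonOfSteps ds)[t]'(by omega)) := by
        rw [List.getLast?_eq_getElem?, List.getElem?_eq_getElem (by omega)]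
        congr 2; omega
      simp [this, h2]

/-- The pairs of a part of `α` and the direction of the box added for it by the algorithm. -/
def steps (l : List ℕ) : Option ℕ → List ℕ → List (ℕ × ℕ) → List (ℕ × (ℕ × ℕ))
  | _, [], _ => []
  | prev, a :: as, R => (a, direction l prev a R) :: steps l (some a) as (R.drop a)

/-- The directions do not depend on the ribbons built so far, so each ribbon can be computed
separately from the steps for its own part. -/
theorem D_loop {n : ℕ} (l : List ℕ) (prev : Option ℕ) (as : List ℕ) (s : State n) (k : Fin n) :
    (loop l prev as s).D k =
      (((steps l prev as s.R).filter fun x => decide (x.1 = (k : ℕ) + 1)).map Prod.snd).foldl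
        extend (s.D k) := by
  induction as generalizing prev s with
  | nil => rfl
  | cons a as ih =>
    rw [loop, ih, steps]
    by_cases h : (k : ℕ) + 1 = a
    · rw [List.filter_cons_of_pos (by simp [h])]
      simp [step, h]
    · rw [List.filter_cons_of_neg (by simpa using Ne.symm h)]
      simp [step, h]

theorem length_steps (l : List ℕ) (prev : Option ℕ) (as : List ℕ) (R : List (ℕ × ℕ)) :
    (steps l prev as R).length = as.length := by
  induction as generalizing prev R with
  | nil => rfl
  | cons a as ih => simp [steps, ih]

theorem getElem_steps (l : List ℕ) (prev : Option ℕ) (as : List ℕ) (R : List (ℕ × ℕ)) (i : ℕ)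
    (h : i < as.length) :
    (steps l prev as R)[i]'(by rwa [length_steps]) =
      (as[i], direction l ((prev :: as.map some).getD i none) as[i] (R.drop (as.take i).sum)) := by
  induction as generalizing prev R i with
  | nil => simp at h
  | cons a as ih =>
    cases i with
    | zero => simp [steps]
    | succ i =>
      simp only [steps, List.getElem_cons_succ]
      rw [ih _ _ _ (by simpa using h)]
      simp [List.drop_drop]

section

variable {n : ℕ} {α β : Composition n}

open Classical in
/-- The direction of the box that is added by the algorithm for the part in row `i`. -/
noncomputable def rowDirection (β α : Composition n) (i : Fin α.length) : ℕ × ℕ :=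
  if ∃ j : Fin α.length, (i : ℕ) = j + 1 ∧ α.blocksFun j = α.blocksFun i then
    if α.sizeUpTo i ∈ partialSums β.blocks then (1, 0) else (0, 1)
  else (1, 1)

theorem steps_eq_map (β α : Composition n) :
    steps β.blocks none α.blocks (ribbonAt (0, 0) β.blocks) =
      (List.finRange α.length).map fun i => (α.blocksFun i, rowDirection β α i) := by
  classical
  apply List.ext_getElem
  · simp [length_steps]
  · intro i h1 h2
    rw [length_steps] at h1
    have hsize : (α.blocks.take i).sum = α.sizeUpTo i := rfl
    have hlt : α.sizeUpTo i < n := sizeUpTo_lt_self (α := α) ⟨i, h1⟩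
    rw [getElem_steps _ _ _ _ _ h1, List.getElem_map, List.getElem_finRange]
    refine Prod.ext rfl ?_
    simp only [direction, rowDirection, Fin.val_cast]
    -- Entry `i` of this shifted list is the part in the row above row `i`, and `none` for the top
    -- row.
    have hprev : (none :: α.blocks.map some).getD i none ≠ some α.blocks[i] ↔
        ¬ ∃ j : Fin α.length, i = j + 1 ∧ α.blocksFun j = α.blocks[i] := by
      rw [not_iff_not]
      cases i with
      | zero => simp
      | succ i =>
        have hi : i < α.blocks.length := by omega
        simp only [List.getD_cons_succ]
        rw [List.getD_eq_getElem _ _ (by simpa using hi), List.getElem_map, Option.some_inj]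
        constructor
        · exact fun h => ⟨⟨i, hi⟩, rfl, h⟩
        · rintro ⟨⟨j, hj⟩, hij, h⟩
          obtain rfl : i = j := by simpa using hij
          exact h
    have hiff := exists_ribbonAt_drop_iff (fun i hi => β.blocks_pos hi) (x := (0, 0))
      (p := α.sizeUpTo i) (by rwa [β.blocks_sum])
    rw [hsize]
    by_cases hc : ∃ j : Fin α.length, i = j + 1 ∧ α.blocksFun j = α.blocks[i]
    · rw [if_neg (fun h => hprev.1 h hc)]
      refine Eq.trans ?_ (if_pos hc).symm
      exact if_congr hiff rfl rfl
    · rw [if_pos (hprev.2 hc)]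
      exact (if_neg hc).symm

theorem D_eq_ribbonOfSteps (β α : Composition n) (k : Fin n) :
    D β α k = ribbonOfSteps (((List.finRange α.length).filter fun i =>
      decide (α.blocksFun i = (k : ℕ) + 1)).map (rowDirection β α)) := by
  rw [D, descentRibbons, D_loop, steps_eq_map, List.filter_map, List.map_map]
  rfl

theorem exists_rowsOfRibbon (β α : Composition n) (k : Fin n) :
    ∃ e : Fin (D β α k).length ≃o {i : Fin α.length // α.blocksFun i = (k : ℕ) + 1},
      ∀ i j : Fin (D β α k).length, (j : ℕ) = i + 1 →
        (D β α k).get j = (D β α k).get i + rowDirection β α (e j) := by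
  rw [D_eq_ribbonOfSteps]
  set l := (List.finRange α.length).filter fun i => decide (α.blocksFun i = (k : ℕ) + 1) with hl
  have hsort : l.SortedLT := ((List.sortedLT_finRange _).pairwise.filter _).sortedLT
  have hlen : (ribbonOfSteps (l.map (rowDirection β α))).length = l.length := by
    simp [length_ribbonOfSteps]
  let e' : {i // i ∈ l} ≃o {i : Fin α.length // α.blocksFun i = (k : ℕ) + 1} :=
    ⟨Equiv.subtypeEquivRight fun i => by simp [hl], Iff.rfl⟩
  refine ⟨((Fin.castOrderIso hlen).trans (List.SortedLT.getIso l hsort)).trans e', ?_⟩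
  rintro ⟨i, hi⟩ ⟨j, hj⟩ rfl
  have := getElem_ribbonOfSteps_succ (l.map (rowDirection β α)) (t := i)
    (hj.trans_eq (length_ribbonOfSteps _))
  simp only [List.get_eq_getElem]
  rw [this, List.getElem_map]
  rfl

end

/-! ### Counting standard descent fillings -/

/-- Both coordinates increase weakly along `B`, so boxes in one row or one column are consecutive,
and it is enough to compare neighbours. A southeast step imposes no condition. -/
theorem isStandardDescent_iff_of_steps {B : List (ℕ × ℕ)} {δ : Fin B.length → ℕ × ℕ}
    (hδ : ∀ i, δ i = (1, 0) ∨ δ i = (0, 1) ∨ δ i = (1, 1))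
    (hB : ∀ i j : Fin B.length, (j : ℕ) = i + 1 → B.get j = B.get i + δ j)
    (f : Equiv.Perm (Fin B.length)) :
    IsStandardDescent B f ↔ ∀ i j : Fin B.length, (j : ℕ) = i + 1 →
      (δ j = (0, 1) → f i < f j) ∧ (δ j = (1, 0) → f j < f i) := by
  have hB1 : ∀ i j : Fin B.length, (j : ℕ) = i + 1 → (B.get j).1 = (B.get i).1 + (δ j).1 :=
    fun i j h => by rw [hB i j h]; rfl
  have hB2 : ∀ i j : Fin B.length, (j : ℕ) = i + 1 → (B.get j).2 = (B.get i).2 + (δ j).2 :=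
    fun i j h => by rw [hB i j h]; rfl
  have hmono : ∀ t : ℕ, ∀ i j : Fin B.length, (j : ℕ) = i + t →
      (B.get i).1 ≤ (B.get j).1 ∧ (B.get i).2 ≤ (B.get j).2 := by
    intro t
    induction t with
    | zero => intro i j h; rw [Fin.ext (a := i) (b := j) (by omega)]; exact ⟨le_rfl, le_rfl⟩
    | succ t ih =>
      intro i j h
      have h1 := ih i ⟨i + t, by omega⟩ rfl
      have h2 := hB1 ⟨i + t, by omega⟩ j (by simp; omega)
      have h3 := hB2 ⟨i + t, by omega⟩ j (by simp; omega)
      omega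
  constructor
  · intro h i j hij
    have h1 := hB1 i j hij
    have h2 := hB2 i j hij
    constructor
    · intro hd
      simp only [hd] at h1 h2
      exact (h i j).1 (by omega) (by omega)
    · intro hd
      simp only [hd] at h1 h2
      exact (h i j).2 (by omega) (by omega)
  · intro h
    have key : ∀ t : ℕ, ∀ i j : Fin B.length, (j : ℕ) = i + 1 + t →
        ((B.get i).1 = (B.get j).1 → f i < f j) ∧ ((B.get i).2 = (B.get j).2 → f j < f i) := by
      intro t
      have base : ∀ i j : Fin B.length, (j : ℕ) = i + 1 →
          ((B.get i).1 = (B.get j).1 → f i < f j) ∧ ((B.get i).2 = (B.get j).2 → f j < f i) := by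
        intro i j hij
        have h1 := hB1 i j hij
        have h2 := hB2 i j hij
        have h3 := h i j hij
        rcases hδ j with hd | hd | hd <;> simp only [hd] at h1 h2 h3
        · exact ⟨fun _ => by omega, fun _ => h3.2 trivial⟩
        · exact ⟨fun _ => h3.1 trivial, fun _ => by omega⟩
        · exact ⟨fun _ => by omega, fun _ => by omega⟩
      induction t with
      | zero => exact base
      | succ t ih =>
        intro i j hij
        let m : Fin B.length := ⟨i + 1 + t, by omega⟩
        have h1 := hmono (1 + t) i m (by simp [m]; omega)
        have h2 := hmono 1 m j (by simp [m]; omega)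
        have h3 := ih i m rfl
        have h4 := base m j (by simp [m]; omega)
        exact ⟨fun he => (h3.1 (by omega)).trans (h4.1 (by omega)),
          fun he => (h4.2 (by omega)).trans (h3.2 (by omega))⟩
    intro i j
    rcases lt_trichotomy (i : ℕ) j with hij | hij | hij
    · have h1 := key (j - i - 1) i j (by omega)
      exact ⟨fun he _ => h1.1 he, fun he _ => h1.2 he⟩
    · obtain rfl := Fin.ext hij
      exact ⟨fun _ h => absurd h (lt_irrefl _), fun _ h => absurd h (lt_irrefl _)⟩
    · have h1 := hmono (i - j) j i (by omega)
      exact ⟨fun _ _ => by omega, fun _ _ => by omega⟩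

section

variable {n : ℕ} {α β : Composition n}

theorem rowDirection_cases (β α : Composition n) (i : Fin α.length) :
    rowDirection β α i = (1, 0) ∨ rowDirection β α i = (0, 1) ∨ rowDirection β α i = (1, 1) := by
  unfold rowDirection
  split_ifs <;> simp

/-- The rows of `α` whose entries contribute the successive boxes of the `k`-th ribbon. -/
noncomputable def rowsOfRibbon (β α : Composition n) (k : Fin n) :
    Fin (D β α k).length ≃o {i : Fin α.length // α.blocksFun i = (k : ℕ) + 1} :=
  (exists_rowsOfRibbon β α k).choose

theorem get_D_succ (k : Fin n) (i j : Fin (D β α k).length) (h : (j : ℕ) = i + 1) :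
    (D β α k).get j = (D β α k).get i + rowDirection β α (rowsOfRibbon β α k j) :=
  (exists_rowsOfRibbon β α k).choose_spec i j h

theorem val_eq_succ_of_rowsOfRibbon {k : Fin n} {s t : Fin (D β α k).length}
    (h : ((rowsOfRibbon β α k t : Fin α.length) : ℕ) = (rowsOfRibbon β α k s : Fin α.length) + 1) :
    (t : ℕ) = s + 1 := by
  have hst : s < t := (rowsOfRibbon β α k).lt_iff_lt.1 (Fin.lt_def.2 (by omega))
  by_contra hne
  rw [Fin.lt_def] at hst
  let u : Fin (D β α k).length := ⟨s + 1, by omega⟩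
  have h1 : rowsOfRibbon β α k s < rowsOfRibbon β α k u :=
    (rowsOfRibbon β α k).lt_iff_lt.2 (Fin.lt_def.2 (by simp [u]))
  have h2 : rowsOfRibbon β α k u < rowsOfRibbon β α k t :=
    (rowsOfRibbon β α k).lt_iff_lt.2 (Fin.lt_def.2 (by simp [u]; omega))
  rw [← Subtype.coe_lt_coe, Fin.lt_def] at h1 h2
  omega

/-- The boxes of all the ribbons correspond to the rows of `α`. -/
noncomputable def boxEquiv (β α : Composition n) :
    (Σ k : Fin n, Fin (D β α k).length) ≃ Fin α.length :=
  Equiv.ofBijective (fun x => (rowsOfRibbon β α x.1 x.2 : Fin α.length)) <| by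
    constructor
    · rintro ⟨k, s⟩ ⟨k', t⟩ h
      have h1 := (rowsOfRibbon β α k s).2
      have h2 := (rowsOfRibbon β α k' t).2
      simp only at h
      rw [h, h2] at h1
      obtain rfl : k = k' := Fin.ext (by omega)
      rw [(rowsOfRibbon β α k).injective (Subtype.ext h)]
    · intro i
      have h1 := α.one_le_blocksFun i
      have h2 := α.blocksFun_le i
      exact ⟨⟨⟨α.blocksFun i - 1, by omega⟩, (rowsOfRibbon β α _).symm ⟨i, by simp⟩⟩,
        by simp⟩

theorem boxEquiv_apply (k : Fin n) (t : Fin (D β α k).length) :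
    boxEquiv β α ⟨k, t⟩ = rowsOfRibbon β α k t := rfl

/-- The permutation of the rows of `α` given by permutations of the boxes of the ribbons. -/
noncomputable def rowPermOfFilling (β α : Composition n)
    (f : ∀ k : Fin n, Equiv.Perm (Fin (D β α k).length)) : RowPerm α :=
  ⟨(boxEquiv β α).symm.trans ((Equiv.sigmaCongrRight f).trans (boxEquiv β α)), fun i => by
    obtain ⟨⟨k, t⟩, rfl⟩ := (boxEquiv β α).surjective i
    have h : ((boxEquiv β α).symm.trans ((Equiv.sigmaCongrRight f).trans (boxEquiv β α)))
        (boxEquiv β α ⟨k, t⟩) = rowsOfRibbon β α k (f k t) := by simp [← boxEquiv_apply]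
    rw [h, boxEquiv_apply, (rowsOfRibbon β α k _).2, (rowsOfRibbon β α k _).2]⟩

theorem rowPermOfFilling_apply (f : ∀ k : Fin n, Equiv.Perm (Fin (D β α k).length)) (k : Fin n)
    (t : Fin (D β α k).length) :
    (rowPermOfFilling β α f).1 (rowsOfRibbon β α k t) = rowsOfRibbon β α k (f k t) := by
  rw [← boxEquiv_apply, ← boxEquiv_apply]
  simp [rowPermOfFilling]

/-- A permutation preserving parts is a family of independent permutations of the sets of rows with
a given part; each such set indexes the boxes of one ribbon. -/
theorem rowPermOfFilling_bijective (β α : Composition n) :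
    Function.Bijective (rowPermOfFilling β α) := by
  constructor
  · intro f g h
    funext k
    ext1 t
    have h1 := rowPermOfFilling_apply f k t
    rw [h, rowPermOfFilling_apply] at h1
    exact ((rowsOfRibbon β α k).injective (Subtype.ext h1)).symm
  · intro σ
    refine ⟨fun k => (rowsOfRibbon β α k).toEquiv.trans ((σ.1.subtypeEquiv fun i => by
      rw [σ.2]).trans (rowsOfRibbon β α k).toEquiv.symm), Subtype.ext (Equiv.ext fun i => ?_)⟩
    obtain ⟨⟨k, t⟩, rfl⟩ := (boxEquiv β α).surjective i
    rw [boxEquiv_apply, rowPermOfFilling_apply]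
    simp

/-- Conditions arise only at boxes whose row in `α` follows a row with the same part, and those two
boxes are neighbours in their ribbon. South means a cut of `β` and asks for a descent; east means no
cut and asks for an ascent. -/
theorem isStandardDescent_D_iff (f : ∀ k : Fin n, Equiv.Perm (Fin (D β α k).length)) :
    (∀ k, IsStandardDescent (D β α k) (f k)) ↔
      ∀ i j : Fin α.length, (j : ℕ) = i + 1 → α.blocksFun i = α.blocksFun j →
        (α.sizeUpTo j ∈ partialSums β.blocks ↔
          (rowPermOfFilling β α f).1 j < (rowPermOfFilling β α f).1 i) := by
  have hk : ∀ k, IsStandardDescent (D β α k) (f k) ↔ _ := fun k =>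
    isStandardDescent_iff_of_steps (fun i => rowDirection_cases β α (rowsOfRibbon β α k i))
      (get_D_succ k) (f k)
  have hlt : ∀ k s t, (rowPermOfFilling β α f).1 (rowsOfRibbon β α k s) <
      (rowPermOfFilling β α f).1 (rowsOfRibbon β α k t) ↔ f k s < f k t := by
    intro k s t
    rw [rowPermOfFilling_apply, rowPermOfFilling_apply, Subtype.coe_lt_coe, OrderIso.lt_iff_lt]
  constructor
  · intro h i j hij ha
    obtain ⟨⟨k, s⟩, rfl⟩ := (boxEquiv β α).surjective i
    obtain ⟨t, rfl⟩ : ∃ t, (rowsOfRibbon β α k t : Fin α.length) = j :=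
      ⟨(rowsOfRibbon β α k).symm ⟨j, by rw [← ha]; exact (rowsOfRibbon β α k s).2⟩, by simp⟩
    rw [boxEquiv_apply] at hij ha ⊢
    rw [hlt]
    have hst := (hk k).1 (h k) s t (val_eq_succ_of_rowsOfRibbon hij)
    have hdir : rowDirection β α (rowsOfRibbon β α k t) = _ :=
      if_pos ⟨rowsOfRibbon β α k s, hij, ha⟩
    rw [hdir] at hst
    by_cases hc : α.sizeUpTo (rowsOfRibbon β α k t : Fin α.length) ∈ partialSums β.blocks
    · rw [if_pos hc] at hst
      exact ⟨fun _ => hst.2 rfl, fun _ => hc⟩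
    · rw [if_neg hc] at hst
      exact ⟨fun h => absurd h hc, fun h => absurd h (lt_asymm (hst.1 rfl))⟩
  · intro h k
    rw [hk]
    intro s t hst
    by_cases hdir : ∃ i : Fin α.length,
        ((rowsOfRibbon β α k t : Fin α.length) : ℕ) = i + 1 ∧
          α.blocksFun i = α.blocksFun (rowsOfRibbon β α k t)
    · have hd : rowDirection β α (rowsOfRibbon β α k t) = _ := if_pos hdir
      obtain ⟨i, hi, ha⟩ := hdir
      obtain ⟨u, rfl⟩ : ∃ u, (rowsOfRibbon β α k u : Fin α.length) = i :=
        ⟨(rowsOfRibbon β α k).symm ⟨i, by rw [ha]; exact (rowsOfRibbon β α k t).2⟩, by simp⟩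
      obtain rfl : u = s := Fin.ext (by have := val_eq_succ_of_rowsOfRibbon hi; omega)
      have h1 := h _ _ hi ha
      rw [hlt] at h1
      rw [hd]
      by_cases hc : α.sizeUpTo (rowsOfRibbon β α k t : Fin α.length) ∈ partialSums β.blocks
      · rw [if_pos hc]
        exact ⟨by simp, fun _ => h1.1 hc⟩
      · rw [if_neg hc]
        refine ⟨fun _ => ?_, by simp⟩
        have hne : f k u ≠ f k t := fun he => by
          have := congrArg Fin.val ((f k).injective he)
          omega
        exact lt_of_le_of_ne (not_lt.1 fun h2 => hc (h1.2 h2)) hne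
    · have hd : rowDirection β α (rowsOfRibbon β α k t) = _ := if_neg hdir
      rw [hd]
      simp

open Classical in
theorem card_SDR (β α : Composition n) :
    (SDR β α).card = ((Finset.univ : Finset (RowPerm α)).filter fun σ =>
      ∀ i j : Fin α.length, (j : ℕ) = i + 1 → α.blocksFun i = α.blocksFun j →
        (α.sizeUpTo j ∈ partialSums β.blocks ↔ σ.1 j < σ.1 i)).card := by
  refine Finset.card_bijective _ (rowPermOfFilling_bijective β α) fun f => ?_
  simp only [SDR, Finset.mem_filter, Finset.mem_univ, true_and, isStandardDescent_D_iff]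

/-! ### The expansion in the fundamental basis -/

theorem refines_compT_iff : Refines (compT α) β ↔ ∀ i j : Fin α.length, (j : ℕ) = i + 1 →
    α.blocksFun j < α.blocksFun i → α.sizeUpTo j ∉ partialSums β.blocks := by
  rw [refines_iff]
  constructor
  · intro h i j hij ha hc
    have h0 := sizeUpTo_pos hij
    have h1 := sizeUpTo_lt_self j
    have h2 : (⟨α.sizeUpTo j - 1, by omega⟩ : Fin (n - 1)) ∈ cuts β :=
      mem_cuts.2 (by simpa [Nat.sub_add_cancel h0] using hc)
    refine mem_cuts_compT.1 (h h2) (isStepSum_blocks_iff.2 ⟨i, j, hij, ha, by simp; omega⟩)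
  · intro h q hq
    rw [mem_cuts_compT, isStepSum_blocks_iff]
    rintro ⟨i, j, hij, ha, he⟩
    exact h i j hij ha (he ▸ mem_cuts.1 hq)

theorem refines_compC_iff : Refines β (compC α) ↔ ∀ i j : Fin α.length, (j : ℕ) = i + 1 →
    α.blocksFun i < α.blocksFun j → α.sizeUpTo j ∈ partialSums β.blocks := by
  rw [refines_iff]
  refine subset_cuts_iff_forall (p := fun i j => α.blocksFun i < α.blocksFun j) fun q => ?_
  simp only [mem_cuts_compC, isStepSum_blocks_iff, and_assoc]

theorem cuts_inter_eq_markedCuts_iff {σ : RowPerm α} :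
    cuts β ∩ cuts α = markedCuts α σ ↔ ∀ i j : Fin α.length, (j : ℕ) = i + 1 →
      (α.sizeUpTo j ∈ partialSums β.blocks ↔ IsMarked α σ i j) := by
  constructor
  · intro h i j hij
    have h0 := sizeUpTo_pos hij
    have h1 := sizeUpTo_lt_self j
    have h2 := Finset.ext_iff.1 h ⟨α.sizeUpTo j - 1, by omega⟩
    rw [Finset.mem_inter, mem_cuts, mem_cuts_iff, mem_markedCuts] at h2
    simp only [Nat.sub_add_cancel h0] at h2
    constructor
    · intro hc
      obtain ⟨i', j', ⟨hij', hm⟩, he⟩ := h2.1 ⟨hc, i, j, hij, rfl⟩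
      obtain rfl : j' = j := Fin.ext (sizeUpTo_inj j'.2.le j.2.le he)
      obtain rfl : i' = i := Fin.ext (by omega)
      exact hm
    · exact fun hm => (h2.2 ⟨i, j, ⟨hij, hm⟩, rfl⟩).1
  · intro h
    ext q
    rw [Finset.mem_inter, mem_cuts, mem_cuts_iff, mem_markedCuts]
    constructor
    · rintro ⟨hq, i, j, hij, he⟩
      exact ⟨i, j, ⟨hij, (h i j hij).1 (he ▸ hq)⟩, he⟩
    · rintro ⟨i, j, ⟨hij, hm⟩, he⟩
      exact ⟨he ▸ (h i j hij).2 hm, i, j, hij, he⟩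

/-- At a position between parts of `α`, the bound `C(α)` governs ascents (a cut is forced), the
bound `T(α)` governs descents (no cut), and the descents of `σ` decide between equal parts. -/
theorem cuts_inter_eq_markedCuts_iff_refines {σ : RowPerm α} :
    cuts β ∩ cuts α = markedCuts α σ ↔ (Refines (compT α) β ∧ Refines β (compC α)) ∧
      ∀ i j : Fin α.length, (j : ℕ) = i + 1 → α.blocksFun i = α.blocksFun j →
        (α.sizeUpTo j ∈ partialSums β.blocks ↔ σ.1 j < σ.1 i) := by
  rw [cuts_inter_eq_markedCuts_iff, refines_compT_iff, refines_compC_iff]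
  constructor
  · refine fun h => ⟨⟨fun i j hij ha hc => ?_, fun i j hij ha => (h i j hij).2 (Or.inl ha)⟩,
      fun i j hij ha => (h i j hij).trans ?_⟩
    · rcases (h i j hij).1 hc with h1 | ⟨h1, -⟩ <;> omega
    · simp [IsMarked, ha]
  · rintro ⟨⟨h1, h2⟩, h3⟩ i j hij
    rcases lt_trichotomy (α.blocksFun i) (α.blocksFun j) with ha | ha | ha
    · exact ⟨fun _ => Or.inl ha, fun _ => h2 i j hij ha⟩
    · rw [h3 i j hij ha]; simp [IsMarked, ha]
    · refine ⟨fun hc => absurd hc (h1 i j hij ha), ?_⟩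
      rintro (h | ⟨h, -⟩) <;> omega

theorem markedCuts_subset_cuts (σ : RowPerm α) : markedCuts α σ ⊆ cuts α :=
  markedCuts_subset_iff.2 fun _ j _ _ => ⟨j, rfl⟩

end

/-! ### Cancellation of signs and comparison of coefficients -/

theorem sum_neg_one_pow_card_sdiff {ι R : Type*} [Fintype ι] [DecidableEq ι] [CommRing R]
    (A G X : Finset ι) (hX : X ⊆ A) :
    ∑ B : Finset ι with B ⊆ G ∧ B ∩ A = X, (-1 : R) ^ (B \ A).card =
      if X ⊆ G ∧ G ⊆ A then 1 else 0 := by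
  by_cases hXG : X ⊆ G
  -- The part of `B` inside `A` is fixed to be `X`, so `B` is determined by `B \ A`, an arbitrary
  -- subset of `G \ A`.
  · have h : ∑ B : Finset ι with B ⊆ G ∧ B ∩ A = X, (-1 : R) ^ (B \ A).card =
        ∑ Y ∈ (G \ A).powerset, (-1 : R) ^ Y.card := by
      refine Finset.sum_bij' (fun B _ => B \ A) (fun Y _ => X ∪ Y) ?_ ?_ ?_ ?_ ?_
      · intro B hB
        simp only [Finset.mem_filter, Finset.mem_univ, true_and] at hB
        exact Finset.mem_powerset.2 (Finset.sdiff_subset_sdiff hB.1 le_rfl)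
      · intro Y hY
        rw [Finset.mem_powerset] at hY
        simp only [Finset.mem_filter, Finset.mem_univ, true_and]
        refine ⟨Finset.union_subset hXG (hY.trans Finset.sdiff_subset), ?_⟩
        ext q
        have h1 := @hX q
        have h2 := @hY q
        simp only [Finset.mem_sdiff, Finset.mem_inter, Finset.mem_union] at h1 h2 ⊢
        tauto
      · intro B hB
        simp only [Finset.mem_filter, Finset.mem_univ, true_and] at hB
        rw [← hB.2, Finset.union_comm, Finset.sdiff_union_inter]
      · intro Y hY
        rw [Finset.mem_powerset] at hY
        ext q
        have h1 := @hX q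
        have h2 := @hY q
        simp only [Finset.mem_sdiff, Finset.mem_union] at h1 h2 ⊢
        tauto
      · intro B _
        rfl
    have h2 := congrArg (Int.cast : ℤ → R) (Finset.sum_powerset_neg_one_pow_card (x := G \ A))
    push_cast at h2
    rw [h, h2]
    simp only [Finset.sdiff_eq_empty_iff_subset, hXG, true_and]
  · rw [if_neg fun h => hXG h.1]
    refine Finset.sum_eq_zero fun B hB => ?_
    simp only [Finset.mem_filter, Finset.mem_univ, true_and] at hB
    exact absurd (hB.2 ▸ Finset.inter_subset_left.trans hB.1) hXG

/-- Equality of the coefficients of `M_γ`: both sides become sums over row permutations `σ`, and for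
each `σ` the signed sum over `β` collapses to an indicator. -/
theorem sum_refines_eq_card {R : Type*} [CommRing R] {n : ℕ} (α γ : Composition n) :
    ∑ β : Composition n with (Refines (compT α) β ∧ Refines β (compC α)) ∧ Refines γ β,
        ((-1 : R) ^ ht β α * ((SDR β α).card : R)) =
      (((DD α).filter fun c => colSum α c = γ).card : R) := by
  classical
  have h1 : ∀ σ : RowPerm α,
      ∑ β : Composition n with cuts β ⊆ cuts γ ∧ cuts β ∩ cuts α = markedCuts α σ,
        (-1 : R) ^ (cuts β \ cuts α).card =
      if markedCuts α σ ⊆ cuts γ ∧ cuts γ ⊆ cuts α then 1 else 0 := by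
    intro σ
    rw [← sum_neg_one_pow_card_sdiff (cuts α) (cuts γ) _ (markedCuts_subset_cuts σ),
      Finset.sum_filter, Finset.sum_filter]
    exact Equiv.sum_comp cuts fun B => if B ⊆ cuts γ ∧ B ∩ cuts α = markedCuts α σ then
      (-1 : R) ^ (B \ cuts α).card else 0
  rw [card_filter_DD_colSum, Finset.card_filter, Nat.cast_sum]
  simp only [Nat.cast_ite, Nat.cast_one, Nat.cast_zero, ← h1]
  simp only [Finset.sum_filter]
  rw [Finset.sum_comm]
  refine Finset.sum_congr rfl fun β _ => ?_
  rw [card_SDR, Finset.card_filter, Nat.cast_sum, ht_eq_card]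
  simp only [cuts_inter_eq_markedCuts_iff_refines, refines_iff (β := β) (α := γ)]
  rw [Finset.mul_sum]
  by_cases h2 : Refines (compT α) β ∧ Refines β (compC α) <;>
    by_cases h3 : cuts β ⊆ cuts γ <;> simp [h2, h3]

end QSymPower

theorem mainTheorem1 (R : Type*) [CommRing R] (n : ℕ) (α : Composition n) :
    QSymPower.powerQ R α =
      ∑ β : Composition n with
          QSymPower.Refines (QSymPower.compT α) β ∧ QSymPower.Refines β (QSymPower.compC α),
        ((-1 : R) ^ QSymPower.ht β α * ((QSymPower.SDR β α).card : R)) •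
          QSymPower.fundamentalQ R β := by
  have h : ∀ β, QSymPower.fundamentalQ R β =
      ∑ γ : Composition n, if QSymPower.Refines γ β then QSymPower.monomialQ R γ else 0 :=
    fun β => by rw [QSymPower.fundamentalQ, Finset.sum_filter]
  simp only [h, Finset.smul_sum]
  -- Both sides are grouped by `γ`, so the multiples of each `M_γ` can be matched one by one.
  rw [Finset.sum_comm, QSymPower.powerQ,
    ← Finset.sum_fiberwise (QSymPower.DD α) (QSymPower.colSum α)]
  refine Finset.sum_congr rfl fun γ _ => ?_
  rw [Finset.sum_congr rfl fun c hc => by rw [(Finset.mem_filter.1 hc).2], Finset.sum_const,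
    ← Nat.cast_smul_eq_nsmul R, ← QSymPower.sum_refines_eq_card, Finset.sum_smul,
    ← Finset.filter_filter, Finset.sum_filter]
  refine Finset.sum_congr rfl fun β _ => ?_
  split_ifs <;> simp
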